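/- Let $n\ge 0$ and let $w\in S_n$. Write $s_i$ for the adjacent transposition $(i\ i{+}1)$, $\ell$ for Coxeter length with respect to $s_1,\dots,s_{n-1}$, and $\operatorname{supp}(w)$ for the set of letters $i$ such that $s_i$ occurs in some reduced word of $w$. Call $w$ fully commutative if any two of its reduced words are related by a sequence of moves interchanging adjacent letters $i,j$ with $|i-j|>1$, and boolean if its principal order ideal in the Bruhat order is isomorphic to a boolean algebra. Let $P(w)$ be the insertion tableau of the one-line notation $w(1)w(2)\cdots w(n)$ under the Robinson–Schensted correspondence. A set $L$ of integers is uncrowded if $|[y,y+2x]\cap L|\le x+1$ for all integers $x,y$ with $x>0$; a permutation $w$ is uncrowded if $P(w)$ has at most two rows and the set of entries of its second row is uncrowded. Let $w\in S_n$ be fully commutative. Then there is a unique boolean permutation $\hat w\in S_n$, the boolean core of $w$, such that $\operatorname{supp}(\hat w)=\operatorname{supp}(w)$ and $w=\hat w w'$ for some $w'\in S_n$ with $\ell(w)=\ell(\hat w)+\ell(w')$. Moreover, $w$ is uncrowded if and only if $P(\hat w)=P(w)$. -/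

import Mathlib

namespace FCPerm

/-! Permutations of `{1, …, n}` are elements of `Equiv.Perm (Fin n)`; the element `i : Fin n` stands
for the number `i + 1`, and the letter `i : Fin (n - 1)` of a word stands for the letter `i + 1`. -/

/-- The simple reflection (adjacent transposition). -/
def simpleReflection {n : ℕ} (i : Fin (n - 1)) : Equiv.Perm (Fin n) :=
  Equiv.swap ⟨i, by omega⟩ ⟨i + 1, by omega⟩

/-- The product of the simple reflections spelled out by a word. -/
def wordProd {n : ℕ} (u : List (Fin (n - 1))) : Equiv.Perm (Fin n) :=
  (u.map simpleReflection).prod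

/-- The Coxeter length: the minimal number of simple reflections in an expression for `w`. -/
noncomputable def length {n : ℕ} (w : Equiv.Perm (Fin n)) : ℕ :=
  sInf {k | ∃ u : List (Fin (n - 1)), u.length = k ∧ wordProd u = w}

/-- The set `R(w)` of reduced words of `w`. -/
def reducedWords {n : ℕ} (w : Equiv.Perm (Fin n)) : Set (List (Fin (n - 1))) :=
  {u | wordProd u = w ∧ u.length = length w}

/-- The support of `w`: the letters appearing in reduced words of `w`. -/
def supp {n : ℕ} (w : Equiv.Perm (Fin n)) : Set (Fin (n - 1)) :=
  {i | ∃ u ∈ reducedWords w, i ∈ u}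

/-- One commutation move: two adjacent letters `i`, `j` with `|i - j| > 1` are interchanged. -/
def CommutationMove {n : ℕ} (u v : List (Fin (n - 1))) : Prop :=
  ∃ (a b : List (Fin (n - 1))) (i j : Fin (n - 1)),
    1 < |((i : ℕ) : ℤ) - ((j : ℕ) : ℤ)| ∧ u = a ++ i :: j :: b ∧ v = a ++ j :: i :: b

/-- All reduced words of `w` form a single commutation class. -/
def IsFullyCommutative {n : ℕ} (w : Equiv.Perm (Fin n)) : Prop :=
  ∀ u ∈ reducedWords w, ∀ v ∈ reducedWords w, Relation.ReflTransGen CommutationMove u v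

/-- The (strong) Bruhat order: the reflexive transitive closure of `u < u t`, for `t` a
transposition with `ℓ(u) < ℓ(u t)`. -/
def BruhatLE {n : ℕ} : Equiv.Perm (Fin n) → Equiv.Perm (Fin n) → Prop :=
  Relation.ReflTransGen fun u v =>
    ∃ a b : Fin n, a ≠ b ∧ v = u * Equiv.swap a b ∧ length u < length v

/-- The principal order ideal of `w` in the Bruhat order is isomorphic to a (finite) boolean
algebra, that is, to the lattice of all subsets of a `k`-element set for some `k`. -/
def IsBoolean {n : ℕ} (w : Equiv.Perm (Fin n)) : Prop :=
  ∃ k : ℕ, Nonempty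
    ((fun u v : {u : Equiv.Perm (Fin n) // BruhatLE u w} => BruhatLE u.1 v.1) ≃r
      (fun A B : Finset (Fin k) => A ⊆ B))

/-- `c` is a (right) boolean core of `w`: it is boolean, it has the same support as `w`, and
`w = c w'` is a length-additive factorization. -/
def IsBooleanCore {n : ℕ} (c w : Equiv.Perm (Fin n)) : Prop :=
  IsBoolean c ∧ supp c = supp w ∧
    ∃ w' : Equiv.Perm (Fin n), w = c * w' ∧ length w = length c + length w'

/-- The one-line notation `w(1) w(2) ⋯ w(n)`. -/
def oneLine {n : ℕ} (w : Equiv.Perm (Fin n)) : List ℕ :=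
  List.ofFn fun i => (w i : ℕ) + 1

/-- Row insertion of `x` into an increasing row: `x` replaces the leftmost entry larger than `x`,
which is returned as the bumped entry; if there is none, `x` is put at the end of the row. -/
def rowInsert : List ℕ → ℕ → List ℕ × Option ℕ
  | [], x => ([x], none)
  | a :: r, x => if x < a then (x :: r, some a) else (a :: (rowInsert r x).1, (rowInsert r x).2)

/-- Schensted insertion of `x` into a tableau, given as the list of its rows from top to bottom:
an entry bumped from a row is inserted into the next row. -/
def tableauInsert : List (List ℕ) → ℕ → List (List ℕ)
  | [], x => [[x]]
  | r :: T, x =>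
    match rowInsert r x with
    | (r', none) => r' :: T
    | (r', some z) => r' :: tableauInsert T z

/-- The insertion tableau `P(w)`, as the list of its rows from top to bottom. -/
def insertionTableau {n : ℕ} (w : Equiv.Perm (Fin n)) : List (List ℕ) :=
  (oneLine w).foldl tableauInsert []

/-- The set of entries in the second row of a tableau (empty if there is no second row). -/
def rowTwo (T : List (List ℕ)) : Set ℤ :=
  {z | ∃ q ∈ T.getD 1 [], (q : ℤ) = z}

/-- `|[y, y + 2x] ∩ L| ≤ x + 1` for all integers `x`, `y` with `x > 0`. -/
def IsUncrowdedSet (L : Set ℤ) : Prop :=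
  ∀ x y : ℤ, 0 < x → ((Set.Icc y (y + 2 * x) ∩ L).ncard : ℤ) ≤ x + 1

/-- A tableau with at most two rows is uncrowded if its second row is an uncrowded set. -/
def IsUncrowdedTableau (T : List (List ℕ)) : Prop :=
  T.length ≤ 2 ∧ IsUncrowdedSet (rowTwo T)

/-- A permutation is uncrowded if its insertion tableau is uncrowded. -/
def IsUncrowded {n : ℕ} (w : Equiv.Perm (Fin n)) : Prop :=
  IsUncrowdedTableau (insertionTableau w)

end FCPerm

namespace FCPerm

/-! Everything is read off from the inversions of a permutation, taken as pairs of values `b < t`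
with `t` to the left of `b`. A fully commutative `w` has no reduced word with a factor `i j i`, `i`
and `j` neighbours, and hence avoids `321` (`BraidFree.avoids321`). Its inversions then relate
disjoint sets of lower and upper entries and satisfy the axioms `IsInvRel`, which are all that the
later combinatorics uses.

Boolean permutations are those whose reduced words have distinct letters (`isBoolean_of_nodup`,
`nodup_of_isBoolean`). For existence of the core, repeated letters of a braid-free reduced word are
pushed to the right until a prefix with distinct letters and full support remains
(`BraidFree.exists_nodup_prefix`). For uniqueness, length-additivity puts the inversions of a core
`c` among those of `w`, equal supports mean that both cross the same cuts, and booleanness forbids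
nested inversions. These facts force the inversions of `c` to be the innermost inversions of `w`
(`IsBooleanCore.inv_iff`).

For a `321`-avoiding permutation, pairing each bumped entry with the entry bumping it gives a stable
matching of the inversion relation, small partners being preferred, and the second row consists of
the matched upper entries (`Avoids321.exists_insertionMatching`). So the claim compares a stable
matching `M` of a relation with a stable matching `N` of its innermost part. Two descents show that
`tops N ⊆ tops M` always and that equality holds if `tops M` is uncrowded (`tops_innermost_subset`,
`tops_innermost_eq`). Since both tableaux have the same entries, equal second rows give equal
tableaux. Conversely, a boolean permutation crosses each cut at most once in each direction, so the
second row of its tableau is always uncrowded (`countIcc_tops_le`), and equality of tableaux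
transfers this to `w`. -/

variable {n : ℕ}

/-! ### Coxeter length and the exchange property. -/

lemma simpleReflection_mul_self (i : Fin (n - 1)) :
    simpleReflection i * simpleReflection i = 1 := Equiv.swap_mul_self _ _

@[simp] lemma wordProd_nil : wordProd ([] : List (Fin (n - 1))) = 1 := rfl

@[simp] lemma wordProd_cons (i : Fin (n - 1)) (u : List (Fin (n - 1))) :
    wordProd (i :: u) = simpleReflection i * wordProd u := by simp [wordProd]

@[simp] lemma wordProd_append (u v : List (Fin (n - 1))) :
    wordProd (u ++ v) = wordProd u * wordProd v := by simp [wordProd]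

lemma exists_wordProd_eq (w : Equiv.Perm (Fin n)) : ∃ u, wordProd u = w := by
  rcases n with _ | n
  · exact ⟨[], Subsingleton.elim _ _⟩
  · have h : w ∈ Submonoid.closure
        (Set.range fun i : Fin n => Equiv.swap i.castSucc i.succ) := by
      rw [Equiv.Perm.mclosure_swap_castSucc_succ]; trivial
    induction h using Submonoid.closure_induction with
    | mem x hx =>
      obtain ⟨i, rfl⟩ := hx
      exact ⟨[i], by simp; rfl⟩
    | one => exact ⟨[], rfl⟩
    | mul x y _ _ hx hy =>
      obtain ⟨u, rfl⟩ := hx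
      obtain ⟨v, rfl⟩ := hy
      exact ⟨u ++ v, wordProd_append u v⟩

lemma length_wordProd_le (u : List (Fin (n - 1))) : length (wordProd u) ≤ u.length :=
  Nat.sInf_le ⟨u, rfl, rfl⟩

lemma exists_reduced (w : Equiv.Perm (Fin n)) : ∃ u, u ∈ reducedWords w := by
  obtain ⟨u, hu⟩ := exists_wordProd_eq w
  obtain ⟨v, h1, h2⟩ := Nat.sInf_mem (s := {k | ∃ u : List (Fin (n - 1)), u.length = k ∧
    wordProd u = w}) ⟨_, u, rfl, hu⟩
  exact ⟨v, h2, h1⟩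

lemma length_mul_le (u v : Equiv.Perm (Fin n)) : length (u * v) ≤ length u + length v := by
  obtain ⟨x, rfl, hx⟩ := exists_reduced u
  obtain ⟨y, rfl, hy⟩ := exists_reduced v
  rw [← hx, ← hy, ← wordProd_append, ← List.length_append]
  exact length_wordProd_le _

/-- The position of the letter `i`, as an element of `Fin n`. -/
abbrev lo (i : Fin (n - 1)) : Fin n := ⟨i, by omega⟩

/-- The position after the letter `i`, as an element of `Fin n`. -/
abbrev hi (i : Fin (n - 1)) : Fin n := ⟨i + 1, by omega⟩

lemma lo_lt_hi (i : Fin (n - 1)) : lo i < hi i := by simp [Fin.lt_def]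

/-- A simple reflection only reverses the order of the two points it exchanges. -/
lemma eq_of_simpleReflection_lt {i : Fin (n - 1)} {x y : Fin n} (hxy : x < y)
    (h : simpleReflection i y < simpleReflection i x) : x = lo i ∧ y = hi i := by
  unfold simpleReflection at *
  simp only [Equiv.swap_apply_def, Fin.ext_iff] at h
  rw [Fin.lt_def] at hxy
  simp only [Fin.ext_iff]
  split_ifs at h <;> rw [Fin.lt_def] at h <;> grind

/-- The exchange property: an inversion is removed by deleting a letter. -/
lemma exists_deletion {a b : Fin n} (hab : a < b) : ∀ u : List (Fin (n - 1)),
    wordProd u b < wordProd u a →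
    ∃ x i y, u = x ++ i :: y ∧ wordProd (x ++ y) = wordProd u * Equiv.swap a b
  | [], h => absurd h (by simpa using hab.le)
  | j :: u, h => by
    rw [wordProd_cons] at h
    rcases lt_or_ge (wordProd u b) (wordProd u a) with h' | h'
    · obtain ⟨x, i, y, rfl, hy⟩ := exists_deletion hab u h'
      exact ⟨j :: x, i, y, rfl, by rw [List.cons_append, wordProd_cons, hy, wordProd_cons,
        mul_assoc]⟩
    -- The first letter creates the inversion, so it exchanges exactly the images of `a` and `b`
    -- under the rest of the word and can be deleted.
    · have h' := lt_of_le_of_ne h' (by simpa using hab.ne)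
      refine ⟨[], j, u, rfl, ?_⟩
      obtain ⟨h1, h2⟩ := eq_of_simpleReflection_lt h' h
      have h3 : simpleReflection j = Equiv.swap (wordProd u a) (wordProd u b) := by
        rw [h1, h2]; rfl
      rw [wordProd_cons, h3, ← Equiv.mul_swap_eq_swap_mul]
      simp [mul_assoc]

lemma length_mul_swap_lt {w : Equiv.Perm (Fin n)} {a b : Fin n} (hab : a < b)
    (h : w b < w a) : length (w * Equiv.swap a b) < length w := by
  obtain ⟨u, rfl, hu⟩ := exists_reduced w
  obtain ⟨x, i, y, rfl, hy⟩ := exists_deletion hab u h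
  rw [← hy, ← hu]
  have := length_wordProd_le (x ++ y)
  simp at *
  omega

lemma lt_length_mul_swap {w : Equiv.Perm (Fin n)} {a b : Fin n} (hab : a < b)
    (h : w a < w b) : length w < length (w * Equiv.swap a b) := by
  simpa [mul_assoc] using length_mul_swap_lt (w := w * Equiv.swap a b) hab (by simpa using h)

lemma length_lt_mul_swap_iff {w : Equiv.Perm (Fin n)} {a b : Fin n} (hab : a < b) :
    length w < length (w * Equiv.swap a b) ↔ w a < w b := by
  refine ⟨fun h => ?_, lt_length_mul_swap hab⟩
  by_contra h'
  have := length_mul_swap_lt hab (lt_of_le_of_ne (not_lt.1 h') (by simpa using hab.ne'))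
  omega

lemma length_simpleReflection_le (i : Fin (n - 1)) : length (simpleReflection i) ≤ 1 := by
  simpa using length_wordProd_le [i]

lemma length_mul_simpleReflection_of_descent {w : Equiv.Perm (Fin n)} {i : Fin (n - 1)}
    (h : w (hi i) < w (lo i)) : length (w * simpleReflection i) + 1 = length w := by
  have h1 := length_mul_swap_lt (lo_lt_hi i) h
  have h2 := length_mul_le (w * simpleReflection i) (simpleReflection i)
  rw [mul_assoc, simpleReflection_mul_self, mul_one] at h2
  have := length_simpleReflection_le i
  change length (w * simpleReflection i) < _ at h1
  omega

/-! ### Reduced words and the Bruhat order -/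

lemma reduced_of_append {x y : List (Fin (n - 1))}
    (h : length (wordProd (x ++ y)) = (x ++ y).length) :
    length (wordProd x) = x.length ∧ length (wordProd y) = y.length := by
  have h1 := length_wordProd_le x
  have h2 := length_wordProd_le y
  have h3 := length_mul_le (wordProd x) (wordProd y)
  rw [← wordProd_append, h, List.length_append] at h3
  omega

lemma bruhatLE_append {x y : List (Fin (n - 1))}
    (h : length (wordProd (x ++ y)) = (x ++ y).length) :
    BruhatLE (wordProd x) (wordProd (x ++ y)) := by
  induction y generalizing x with
  | nil => rw [List.append_nil]; exact Relation.ReflTransGen.refl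
  | cons i y ih =>
    have e : x ++ i :: y = (x ++ [i]) ++ y := by simp
    rw [e] at h ⊢
    refine Relation.ReflTransGen.head ⟨lo i, hi i, (lo_lt_hi i).ne, ?_, ?_⟩ (ih h)
    · simp [simpleReflection]
    · have h1 := (reduced_of_append h).1
      rw [h1, (reduced_of_append h1).1]
      simp

lemma one_bruhatLE (w : Equiv.Perm (Fin n)) : BruhatLE 1 w := by
  obtain ⟨u, rfl, hu⟩ := exists_reduced w
  exact bruhatLE_append (x := []) (y := u) hu.symm

lemma length_le_of_bruhatLE {u v : Equiv.Perm (Fin n)} (h : BruhatLE u v) :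
    u = v ∨ length u < length v := by
  induction h with
  | refl => exact .inl rfl
  | tail _ h ih =>
    obtain ⟨_, _, _, _, h⟩ := h
    rcases ih with rfl | ih
    · exact .inr h
    · exact .inr (ih.trans h)

lemma bruhatLE_antisymm {u v : Equiv.Perm (Fin n)} (h : BruhatLE u v) (h' : BruhatLE v u) :
    u = v := by
  rcases length_le_of_bruhatLE h with h | h
  · exact h
  · rcases length_le_of_bruhatLE h' with h' | h'
    · exact h'.symm
    · omega

/-- A Bruhat step, with the transposed positions in increasing order. -/
lemma exists_lt_of_bruhat_step {u v : Equiv.Perm (Fin n)}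
    (h : ∃ a b : Fin n, a ≠ b ∧ v = u * Equiv.swap a b ∧ length u < length v) :
    ∃ a b : Fin n, a < b ∧ u a < u b ∧ v = u * Equiv.swap a b := by
  obtain ⟨a, b, hab, rfl, h⟩ := h
  rcases lt_or_gt_of_ne hab with hab | hab
  · exact ⟨a, b, hab, (length_lt_mul_swap_iff hab).1 h, rfl⟩
  · rw [Equiv.swap_comm] at h ⊢
    exact ⟨b, a, hab, (length_lt_mul_swap_iff hab).1 h, rfl⟩

/-! ### Cuts preserved by a permutation -/

/-- `w` maps the first `i` points to themselves. -/
def Fixes (i : ℕ) (w : Equiv.Perm (Fin n)) : Prop :=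
  ∀ a : Fin n, (a : ℕ) < i → (w a : ℕ) < i

lemma Fixes.mul {i : ℕ} {u v : Equiv.Perm (Fin n)} (hu : Fixes i u) (hv : Fixes i v) :
    Fixes i (u * v) := fun a ha => hu _ (hv a ha)

lemma Fixes.inv {i : ℕ} {w : Equiv.Perm (Fin n)} (h : Fixes i w) : Fixes i w⁻¹ := by
  exact fun a ha => Equiv.Perm.perm_symm_mapsTo_of_mapsTo w (s := {a : Fin n | (a : ℕ) < i})
    (fun a ha => h a ha) ha

lemma fixes_simpleReflection {i : ℕ} {j : Fin (n - 1)} (h : i ≠ j + 1) :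
    Fixes i (simpleReflection j) := by
  intro a ha
  simp only [simpleReflection, Equiv.swap_apply_def]
  split_ifs <;> simp_all [Fin.ext_iff] <;> omega

lemma not_fixes_simpleReflection (j : Fin (n - 1)) :
    ¬ Fixes ((j : ℕ) + 1) (simpleReflection j) := by
  intro h
  have := h (lo j) (by simp)
  simp [simpleReflection] at this

lemma fixes_wordProd {i : Fin (n - 1)} {u : List (Fin (n - 1))} (h : i ∉ u) :
    Fixes ((i : ℕ) + 1) (wordProd u) := by
  induction u with
  | nil => exact fun a ha => ha
  | cons j u ih =>
    simp only [List.mem_cons, not_or] at h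
    rw [wordProd_cons]
    exact (fixes_simpleReflection (by simpa [Fin.ext_iff] using h.1)).mul (ih h.2)

/-- Going down a Bruhat step puts the smaller value at the earlier position, which cannot create a
crossing of the cut. Hence supports grow along the Bruhat order. -/
lemma Fixes.of_bruhatLE {i : ℕ} {u v : Equiv.Perm (Fin n)} (huv : BruhatLE u v)
    (h : Fixes i v) : Fixes i u := by
  induction huv with
  | refl => exact h
  | tail _ hs ih =>
    apply ih
    obtain ⟨a, b, hab, hlt, rfl⟩ := exists_lt_of_bruhat_step hs
    intro x hx
    have ha := h a
    have hb := h b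
    have hx' := h x hx
    simp only [Equiv.Perm.mul_apply, Equiv.swap_apply_left, Equiv.swap_apply_right] at ha hb hx'
    rw [Fin.lt_def] at hab hlt
    by_cases h1 : x = a
    · subst h1; have := ha hx; omega
    by_cases h2 : x = b
    · subst h2; exact ha (by omega)
    rwa [Equiv.swap_apply_of_ne_of_ne h1 h2] at hx'

/-- A reduced word involves exactly the letters whose cut is not preserved. -/
lemma mem_reduced_iff {u : List (Fin (n - 1))} (hu : length (wordProd u) = u.length)
    (i : Fin (n - 1)) : i ∈ u ↔ ¬ Fixes ((i : ℕ) + 1) (wordProd u) := by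
  refine ⟨fun hi hf => ?_, fun h => by_contra fun h' => h (fixes_wordProd h')⟩
  -- Cut at the first occurrence of `i`: the prefix before it preserves the cut, and the prefix
  -- through it does so too, lying below `w`; hence so would the reflection itself.
  obtain ⟨x, y, rfl, hx⟩ := List.eq_append_cons_of_mem hi
  have e : x ++ i :: y = (x ++ [i]) ++ y := by simp
  rw [e] at hu hf
  have h1 := hf.of_bruhatLE (bruhatLE_append hu)
  have h2 := (fixes_wordProd hx).inv.mul h1
  apply not_fixes_simpleReflection i
  simpa using h2

lemma mem_supp_iff (w : Equiv.Perm (Fin n)) (i : Fin (n - 1)) :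
    i ∈ supp w ↔ ¬ Fixes ((i : ℕ) + 1) w := by
  constructor
  · rintro ⟨u, ⟨rfl, hu⟩, hi⟩
    exact (mem_reduced_iff hu.symm i).1 hi
  · obtain ⟨u, rfl, hu⟩ := exists_reduced w
    exact fun h => ⟨u, ⟨rfl, hu⟩, (mem_reduced_iff hu.symm i).2 h⟩

/-! ### Boolean permutations -/

lemma not_fixes_of_nodup {u : List (Fin (n - 1))} (hu : u.Nodup) {i : Fin (n - 1)} (hi : i ∈ u) :
    ¬ Fixes ((i : ℕ) + 1) (wordProd u) := by
  intro h
  obtain ⟨x, y, rfl⟩ := List.append_of_mem hi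
  have hd := hu
  rw [List.nodup_append] at hd
  simp only [List.nodup_cons] at hd
  have hx : i ∉ x := fun h' => hd.2.2 i h' i (by simp) rfl
  apply not_fixes_simpleReflection i
  have := ((fixes_wordProd hx).inv.mul h).mul (fixes_wordProd hd.2.1.1).inv
  simpa [mul_assoc] using this

lemma length_of_nodup {u : List (Fin (n - 1))} (hu : u.Nodup) :
    length (wordProd u) = u.length := by
  refine (length_wordProd_le u).antisymm ?_
  obtain ⟨v, hv, hl⟩ := exists_reduced (wordProd u)
  rw [← hl, ← List.toFinset_card_of_nodup hu]
  refine (Finset.card_le_card fun i hi => ?_).trans (List.toFinset_card_le v)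
  rw [List.mem_toFinset] at hi ⊢
  by_contra h
  exact not_fixes_of_nodup hu hi (hv ▸ fixes_wordProd h)

lemma bruhat_step_deletion {x y : List (Fin (n - 1))} {i : Fin (n - 1)}
    (h : (x ++ i :: y).Nodup) : BruhatLE (wordProd (x ++ y)) (wordProd (x ++ i :: y)) := by
  have h' : (x ++ y).Nodup := h.sublist (by simp)
  refine Relation.ReflTransGen.single
    ⟨(wordProd y)⁻¹ (lo i), (wordProd y)⁻¹ (hi i), ?_, ?_, ?_⟩
  · simp
  · rw [Equiv.swap_apply_apply]
    simp [simpleReflection, mul_assoc]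
  · rw [length_of_nodup h, length_of_nodup h']
    simp

lemma bruhatLE_of_sublist {u v : List (Fin (n - 1))} (h : u.Sublist v) (hv : v.Nodup) :
    BruhatLE (wordProd u) (wordProd v) := by
  suffices ∀ x : List (Fin (n - 1)), (x ++ v).Nodup →
      BruhatLE (wordProd (x ++ u)) (wordProd (x ++ v)) by simpa using this [] (by simpa)
  clear hv
  induction h with
  | slnil => exact fun x _ => Relation.ReflTransGen.refl
  | cons i _ ih =>
    intro x hx
    exact (ih x (hx.sublist (by simp))).trans (bruhat_step_deletion hx)
  | cons_cons i _ ih =>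
    intro x hx
    simpa using ih (x ++ [i]) (by simpa using hx)

/-- The subword property: each step down the Bruhat order deletes one letter, by the exchange
property. -/
lemma exists_sublist_of_bruhatLE {u : List (Fin (n - 1))} {v : Equiv.Perm (Fin n)}
    (h : BruhatLE v (wordProd u)) : ∃ x : List (Fin (n - 1)), x.Sublist u ∧ wordProd x = v := by
  induction h using Relation.ReflTransGen.head_induction_on with
  | refl => exact ⟨u, List.Sublist.refl u, rfl⟩
  | head hs _ ih =>
    obtain ⟨x, hx, rfl⟩ := ih
    obtain ⟨a, b, hab, hlt, e⟩ := exists_lt_of_bruhat_step hs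
    obtain ⟨y, i, z, rfl, hz⟩ := exists_deletion hab x (by rw [e]; simpa using hlt)
    refine ⟨y ++ z, .trans (by simp) hx, ?_⟩
    rw [hz, e, mul_assoc, Equiv.swap_mul_self, mul_one]

lemma filter_mem_eq_of_sublist {α : Type*} [DecidableEq α] {x u : List α} (h : x.Sublist u)
    (hu : u.Nodup) : u.filter (· ∈ x) = x := by
  have h1 : x.Sublist (u.filter (· ∈ x)) := by
    have := h.filter (· ∈ x)
    rwa [List.filter_eq_self.2 (by simp)] at this
  refine (h1.eq_of_length (List.Perm.length_eq ?_)).symm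
  rw [List.perm_ext_iff_of_nodup (hu.sublist h) (hu.filter _)]
  exact fun a => ⟨fun ha => h1.subset ha, fun ha => by simpa using (List.mem_filter.1 ha).2⟩

/-- Sets of letters of `u` correspond to its subwords, hence to the elements below. The order is
reflected because the letters of such a subword are recovered from the cuts that its product fails
to preserve. -/
lemma isBoolean_of_nodup {u : List (Fin (n - 1))} (hu : u.Nodup) : IsBoolean (wordProd u) := by
  classical
  refine ⟨u.length, ⟨RelIso.symm ?_⟩⟩
  let g (A : Finset (Fin u.length)) : List (Fin (n - 1)) := u.filter fun i => ∃ j ∈ A, u.get j = i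
  have hg (A) : (g A).Sublist u := List.filter_sublist
  have hgn (A) : (g A).Nodup := hu.sublist (hg A)
  have hmem (A) (j : Fin u.length) : u.get j ∈ g A ↔ j ∈ A := by
    simp only [g, List.mem_filter, decide_eq_true_eq]
    constructor
    · rintro ⟨_, j', hj', e⟩
      rwa [← hu.injective_get e]
    · exact fun h => ⟨List.get_mem _ _, j, h, rfl⟩
  let f : Finset (Fin u.length) → {v // BruhatLE v (wordProd u)} :=
    fun A => ⟨wordProd (g A), bruhatLE_of_sublist (hg A) hu⟩
  have hf (A B) : BruhatLE (f A).1 (f B).1 ↔ A ⊆ B := by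
    constructor
    · intro h j hj
      rw [← hmem] at hj ⊢
      by_contra h'
      exact not_fixes_of_nodup (hgn A) hj ((fixes_wordProd h').of_bruhatLE h)
    · intro h
      refine bruhatLE_of_sublist (List.monotone_filter_right _ fun i hi => ?_) (hgn B)
      simp only [decide_eq_true_eq] at hi ⊢
      obtain ⟨j, hj, e⟩ := hi
      exact ⟨j, h hj, e⟩
  have hinj : Function.Injective f := fun A B h =>
    Finset.Subset.antisymm ((hf A B).1 (h ▸ Relation.ReflTransGen.refl))
      ((hf B A).1 (h ▸ Relation.ReflTransGen.refl))
  refine RelIso.ofSurjective ⟨⟨f, hinj⟩, hf _ _⟩ ?_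
  rintro ⟨v, hv⟩
  obtain ⟨x, hx, rfl⟩ := exists_sublist_of_bruhatLE hv
  refine ⟨Finset.univ.filter fun j => u.get j ∈ x, Subtype.ext ?_⟩
  change wordProd (g _) = _
  congr 1
  refine Eq.trans ?_ (filter_mem_eq_of_sublist hx hu)
  refine List.filter_congr fun i hi => ?_
  obtain ⟨j, rfl⟩ := List.mem_iff_get.1 hi
  simp only [Finset.mem_filter, Finset.mem_univ, true_and, decide_eq_decide]
  exact ⟨fun ⟨j', h, e⟩ => e ▸ h, fun h => ⟨j, h, rfl⟩⟩

/-- Compare with the rank `k` of the boolean algebra: the prefixes of `u` form a chain, so `u.length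
≤ k`, while the `k` atoms are distinct simple reflections whose letters occur in `u`. -/
lemma nodup_of_isBoolean {u : List (Fin (n - 1))} (hu : length (wordProd u) = u.length)
    (h : IsBoolean (wordProd u)) : u.Nodup := by
  classical
  obtain ⟨k, ⟨e⟩⟩ := h
  have hmono {x y} (h : BruhatLE x.1 y.1) : e x ⊆ e y := e.map_rel_iff.2 h
  have h1 : u.length ≤ k := by
    have : ∀ x y (hxy : u = x ++ y),
        x.length ≤ (e ⟨wordProd x, by subst hxy; exact bruhatLE_append hu⟩).card := by
      intro x
      induction x using List.reverseRecOn with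
      | nil => intros; simp
      | append_singleton x i ih =>
        intro y hxy
        have hle : length (wordProd (x ++ [i])) = (x ++ [i]).length := by
          subst hxy; exact (reduced_of_append hu).1
        have hx := (reduced_of_append hle).1
        have h2 := ih ([i] ++ y) (by simpa using hxy)
        rw [List.length_append, List.length_singleton]
        refine Nat.lt_of_le_of_lt h2 (Finset.card_lt_card (lt_of_le_of_ne
          (hmono (x := ⟨wordProd x, _⟩) (y := ⟨wordProd (x ++ [i]), _⟩)
            (bruhatLE_append hle)) fun h3 => ?_))
        have h4 := congrArg length (congrArg Subtype.val (e.injective h3))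
        simp only [hle, hx] at h4
        simp at h4
    exact (this u [] (by simp)).trans (by simpa using Finset.card_le_univ (e _))
  have h0 (v) (hv : e v = ∅) : v.1 = 1 := by
    refine (bruhatLE_antisymm (one_bruhatLE v.1) ?_).symm
    have : e v ⊆ e ⟨1, one_bruhatLE _⟩ := by rw [hv]; simp
    exact e.map_rel_iff.1 this
  have h2 : ∀ j : Fin k, ∃ i ∈ u, (e.symm {j}).1 = simpleReflection i := by
    intro j
    obtain ⟨x, hx, hl⟩ := exists_reduced (e.symm {j}).1
    rcases x with _ | ⟨i, x⟩
    · have h3 : e.symm {j} = ⟨1, one_bruhatLE _⟩ := Subtype.ext hx.symm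
      have h4 : e.symm {j} = e.symm ∅ := by
        rw [h3]
        exact Subtype.ext (h0 _ (by simp)).symm
      simpa using e.symm.injective h4
    · have h3 : BruhatLE (simpleReflection i) (e.symm {j}).1 := by
        rw [← hx] at hl ⊢
        simpa using bruhatLE_append (x := [i]) (y := x) hl.symm
      have h4 := h3.trans (e.symm {j}).2
      refine ⟨i, (mem_reduced_iff hu i).2 fun h5 =>
        not_fixes_simpleReflection i (h5.of_bruhatLE h4), ?_⟩
      have h5 := hmono (x := ⟨_, h4⟩) (y := e.symm {j}) h3
      rw [RelIso.apply_symm_apply, Finset.subset_singleton_iff] at h5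
      rcases h5 with h5 | h5
      · have h6 : simpleReflection i = 1 := h0 _ h5
        have := not_fixes_simpleReflection i (by rw [h6]; exact fun a ha => ha)
        exact this.elim
      · rw [← h5, RelIso.symm_apply_apply]
  choose f hf hf' using h2
  have h3 : k ≤ u.toFinset.card := by
    have : Function.Injective f := fun j j' h => by
      have : e.symm {j} = e.symm {j'} := Subtype.ext (by rw [hf', hf', h])
      simpa using e.symm.injective this
    simpa using Finset.card_le_card_of_injOn (s := Finset.univ) (t := u.toFinset) f
      (fun j _ => by simpa using hf j) this.injOn
  rw [← Multiset.coe_nodup, ← Multiset.toFinset_card_eq_card_iff_nodup]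
  have := List.toFinset_card_le u
  simp only [Multiset.coe_card]
  change u.toFinset.card = _
  omega

/-! ### Braids in reduced words -/

/-- Two letters are neighbours. -/
def Adj (i j : Fin (n - 1)) : Prop := (i : ℕ) + 1 = j ∨ (j : ℕ) + 1 = i

lemma simpleReflection_comm {i j : Fin (n - 1)} (hij : i ≠ j) (h : ¬ Adj i j) :
    simpleReflection i * simpleReflection j = simpleReflection j * simpleReflection i := by
  unfold Adj at h
  have h' : (i : ℕ) ≠ j := fun e => hij (Fin.ext e)
  apply Equiv.Perm.Disjoint.commute
  intro x
  simp only [simpleReflection, Equiv.swap_apply_def, Fin.ext_iff]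
  split_ifs <;> grind

lemma simpleReflection_braid_aux {i j : Fin (n - 1)} (h : (i : ℕ) + 1 = j) :
    simpleReflection i * simpleReflection j * simpleReflection i =
      simpleReflection j * simpleReflection i * simpleReflection j := by
  have e : hi i = lo j := Fin.ext h
  have e1 : simpleReflection i = Equiv.swap (lo i) (lo j) := by rw [← e]; rfl
  have e2 : simpleReflection j = Equiv.swap (lo j) (hi j) := rfl
  have h1 : lo i ≠ lo j := by simp [Fin.ext_iff]; omega
  have h2 : lo i ≠ hi j := by simp [Fin.ext_iff]; omega
  have h3 : lo j ≠ hi j := (lo_lt_hi j).ne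
  rw [e1, e2, Equiv.swap_mul_swap_mul_swap h1 h2, Equiv.swap_comm (lo i) (lo j),
    Equiv.swap_comm (lo j) (hi j), Equiv.swap_mul_swap_mul_swap h3.symm h2.symm,
    Equiv.swap_comm]

lemma simpleReflection_braid {i j : Fin (n - 1)} (h : Adj i j) :
    simpleReflection i * simpleReflection j * simpleReflection i =
      simpleReflection j * simpleReflection i * simpleReflection j := by
  rcases h with h | h
  · exact simpleReflection_braid_aux h
  · exact (simpleReflection_braid_aux h).symm

/-- No reduced word of `w` has a factor `i j i` with `i`, `j` neighbours. -/
def BraidFree (w : Equiv.Perm (Fin n)) : Prop :=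
  ∀ x y : List (Fin (n - 1)), ∀ i j, Adj i j → x ++ i :: j :: i :: y ∉ reducedWords w

lemma CommutationMove.perm {u v : List (Fin (n - 1))} (h : CommutationMove u v) : u.Perm v := by
  obtain ⟨a, b, i, j, _, rfl, rfl⟩ := h
  exact (List.Perm.swap _ _ _).append_left _

/-- A braid move changes the number of occurrences of a letter, whereas commutation moves only
permute the word. -/
lemma IsFullyCommutative.braidFree {w : Equiv.Perm (Fin n)} (hw : IsFullyCommutative w) :
    BraidFree w := by
  rintro x y i j hij hu
  have hv : x ++ j :: i :: j :: y ∈ reducedWords w := by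
    refine ⟨?_, by simpa using hu.2⟩
    rw [← hu.1]
    have := congrArg (fun g => wordProd x * (g * wordProd y)) (simpleReflection_braid hij)
    simpa [mul_assoc] using this.symm
  have hp : (x ++ i :: j :: i :: y).Perm (x ++ j :: i :: j :: y) := by
    have h (u v : List (Fin (n - 1))) (h : Relation.ReflTransGen CommutationMove u v) :
        u.Perm v := by
      induction h with
      | refl => rfl
      | tail _ h ih => exact ih.trans h.perm
    exact h _ _ (hw _ hu _ hv)
  have hne : i ≠ j := by rintro rfl; simp [Adj] at hij
  have := hp.count_eq i
  simp [List.count_append, hne.symm] at this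

lemma BraidFree.of_append {x y : List (Fin (n - 1))} (h : BraidFree (wordProd (x ++ y)))
    (hr : length (wordProd (x ++ y)) = (x ++ y).length) : BraidFree (wordProd x) := by
  rintro a b i j hij ⟨h1, h2⟩
  refine h a (b ++ y) i j hij ⟨?_, ?_⟩
  · rw [wordProd_append x y, ← h1]
    simp [mul_assoc]
  · rw [hr]
    rw [(reduced_of_append hr).1] at h2
    simp at h2 ⊢
    omega

lemma BraidFree.of_descent {w : Equiv.Perm (Fin n)} (h : BraidFree w) {i : Fin (n - 1)}
    (hi : w (hi i) < w (lo i)) : BraidFree (w * simpleReflection i) := by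
  have hl := length_mul_simpleReflection_of_descent hi
  obtain ⟨u, hu, hu'⟩ := exists_reduced (w * simpleReflection i)
  have e : wordProd (u ++ [i]) = w := by simp [hu, mul_assoc, simpleReflection_mul_self]
  rw [← hu]
  apply BraidFree.of_append (y := [i])
  · rwa [e]
  · rw [e, List.length_append, hu', ← hl]; rfl

/-! ### Pattern avoidance. -/

/-- `w` avoids the pattern `321`. -/
def Avoids321 (w : Equiv.Perm (Fin n)) : Prop :=
  ∀ a b c : Fin n, a < b → b < c → w c < w b → w b < w a → False

lemma exists_descent {w : Equiv.Perm (Fin n)} {a b : Fin n} (hab : a < b) (h : w b < w a) :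
    ∃ i : Fin (n - 1), a ≤ lo i ∧ hi i ≤ b ∧ w (hi i) < w (lo i) := by
  by_contra! hc
  have : ∀ k (hk : (a : ℕ) + k < n), (a : ℕ) + k ≤ b → w a ≤ w ⟨a + k, hk⟩ := by
    intro k
    induction k with
    | zero => intros; exact le_rfl
    | succ k ih =>
      intro hk hb
      refine (ih (by omega) (by omega)).trans ?_
      exact hc ⟨a + k, by omega⟩ (by simp [Fin.le_def]) (Fin.le_def.2 (by simp; omega))
  have h1 := this (b - a) (by have := b.2; rw [Fin.lt_def] at hab; omega)
    (by rw [Fin.lt_def] at hab; omega)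
  have h2 : (⟨(a : ℕ) + (b - a), by have := b.2; rw [Fin.lt_def] at hab; omega⟩ : Fin n) = b :=
    Fin.ext (by rw [Fin.lt_def] at hab; simp; omega)
  rw [h2] at h1
  exact absurd h (not_lt.2 h1)

/-- Induct on length. A descent that is not one of the two steps of the pattern can be undone while
keeping the pattern, so the pattern occupies consecutive positions; then `w` has a reduced word
ending in `i j i`. -/
lemma BraidFree.avoids321 {w : Equiv.Perm (Fin n)} (h : BraidFree w) : Avoids321 w := by
  induction hk : length w using Nat.strong_induction_on generalizing w with
  | _ k ih =>
  subst hk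
  intro a b c hab hbc hcb hba
  have key : ∀ i : Fin (n - 1), w (hi i) < w (lo i) →
      (a = lo i ∧ b = hi i) ∨ (b = lo i ∧ c = hi i) := by
    intro i hi
    by_contra! hc
    have hl := length_mul_simpleReflection_of_descent hi
    have hs (x : Fin n) : simpleReflection i (simpleReflection i x) = x := by
      rw [← Equiv.Perm.mul_apply, simpleReflection_mul_self]; rfl
    have ho {x y : Fin n} (hxy : x < y) (hne : x = lo i → y ≠ FCPerm.hi i) :
        simpleReflection i x < simpleReflection i y := by
      refine lt_of_le_of_ne (not_lt.1 fun h' => ?_) (by simpa using hxy.ne)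
      obtain ⟨h1, h2⟩ := eq_of_simpleReflection_lt hxy h'
      exact hne h1 h2
    refine ih _ (by omega) (h.of_descent hi) rfl _ _ _ (ho hab hc.1) (ho hbc hc.2) ?_ ?_
    · simpa [hs] using hcb
    · simpa [hs] using hba
  obtain ⟨i, hi1, hi2, hi3⟩ := exists_descent hab hba
  obtain ⟨j, hj1, hj2, hj3⟩ := exists_descent hbc hcb
  have hi4 : a = lo i ∧ b = hi i := by
    rcases key i hi3 with h' | h'
    · exact h'
    · exact absurd hi2 (not_le.2 (h'.1 ▸ lo_lt_hi i))
  have hj4 : b = lo j ∧ c = hi j := by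
    rcases key j hj3 with h' | h'
    · exact absurd hj1 (not_le.2 (h'.2 ▸ lo_lt_hi j))
    · exact h'
  have si : simpleReflection i = Equiv.swap a b := by rw [hi4.1, hi4.2]; rfl
  have sj : simpleReflection j = Equiv.swap b c := by rw [hj4.1, hj4.2]; rfl
  have hac := hab.trans hbc
  have e1 := length_mul_simpleReflection_of_descent hi3
  have e2 := length_mul_simpleReflection_of_descent (w := w * simpleReflection i) (i := j) (by
    rw [← hj4.1, ← hj4.2, si]
    simpa [Equiv.swap_apply_of_ne_of_ne hac.ne' hbc.ne'] using hcb.trans hba)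
  have e3 := length_mul_simpleReflection_of_descent
    (w := w * simpleReflection i * simpleReflection j) (i := i) (by
      rw [← hi4.1, ← hi4.2, si, sj]
      simpa [Equiv.swap_apply_of_ne_of_ne hac.ne' hbc.ne',
        Equiv.swap_apply_of_ne_of_ne hab.ne hac.ne] using hcb)
  obtain ⟨u, hu, hu'⟩ :=
    exists_reduced (w * simpleReflection i * simpleReflection j * simpleReflection i)
  refine h u [] i j (.inl ?_) ⟨?_, ?_⟩
  · have := hi4.2.symm.trans hj4.1
    simpa [Fin.ext_iff] using this
  · have hs := simpleReflection_mul_self (n := n)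
    have hs' (x : Fin (n - 1)) (g : Equiv.Perm (Fin n)) :
      simpleReflection x * (simpleReflection x * g) = g := by rw [← mul_assoc, hs, one_mul]
    simp [hu, mul_assoc, hs, hs']
  · simp; omega

/-! ### Inversions -/

/-- The pairs of values `b < t` such that `t` stands to the left of `b`. -/
def Inv (w : Equiv.Perm (Fin n)) (b t : ℕ) : Prop :=
  ∃ i j : Fin n, i < j ∧ w j < w i ∧ (w j : ℕ) = b ∧ (w i : ℕ) = t

lemma Inv.mul_simpleReflection {w : Equiv.Perm (Fin n)} {i : Fin (n - 1)}
    (h : w (lo i) < w (hi i)) {b t : ℕ} (hbt : Inv w b t) : Inv (w * simpleReflection i) b t := by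
  obtain ⟨p, q, hpq, hlt, hb, ht⟩ := hbt
  have hs (x : Fin n) : simpleReflection i (simpleReflection i x) = x := by
    rw [← Equiv.Perm.mul_apply, simpleReflection_mul_self]; rfl
  refine ⟨simpleReflection i p, simpleReflection i q, ?_, by simpa [hs], by simpa [hs],
    by simpa [hs]⟩
  refine lt_of_le_of_ne (not_lt.1 fun h' => ?_) (by simpa using hpq.ne)
  obtain ⟨rfl, rfl⟩ := eq_of_simpleReflection_lt hpq h'
  exact lt_asymm h hlt

lemma Inv.append {x y : List (Fin (n - 1))}
    (h : length (wordProd (x ++ y)) = (x ++ y).length) {b t : ℕ} (hbt : Inv (wordProd x) b t) :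
    Inv (wordProd (x ++ y)) b t := by
  induction y generalizing x with
  | nil => simpa using hbt
  | cons i y ih =>
    have e : x ++ i :: y = (x ++ [i]) ++ y := by simp
    rw [e] at h ⊢
    refine ih h ?_
    have h1 := (reduced_of_append h).1
    have h2 := (reduced_of_append h1).1
    have h3 : wordProd (x ++ [i]) = wordProd x * simpleReflection i := by simp
    rw [h3] at h1 ⊢
    refine hbt.mul_simpleReflection ((length_lt_mul_swap_iff (lo_lt_hi i)).1 ?_)
    change _ < length (wordProd x * simpleReflection i)
    rw [h1, h2]
    simp

/-- Right multiplication permutes positions, so each length-increasing letter keeps the inverted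
pairs of values. -/
lemma Inv.mul {c v : Equiv.Perm (Fin n)} (h : length (c * v) = length c + length v) {b t : ℕ}
    (hbt : Inv c b t) : Inv (c * v) b t := by
  obtain ⟨x, rfl, hx⟩ := exists_reduced c
  obtain ⟨y, rfl, hy⟩ := exists_reduced v
  rw [← wordProd_append] at h ⊢
  exact Inv.append (by rw [h, List.length_append, hx, hy]) hbt

/-- The inversions determine the left-to-right order of the values, so `w⁻¹ * v` is strictly
increasing and therefore trivial. -/
lemma eq_of_inv_iff {v w : Equiv.Perm (Fin n)} (h : ∀ b t, Inv v b t ↔ Inv w b t) : v = w := by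
  have hlt {v : Equiv.Perm (Fin n)} {x y : Fin n} (hxy : x < y) :
      v⁻¹ y < v⁻¹ x ↔ Inv v x y := by
    constructor
    · exact fun h => ⟨_, _, h, by simpa, by simp, by simp⟩
    · rintro ⟨i, j, hij, _, h1, h2⟩
      obtain rfl := Fin.ext h1
      obtain rfl := Fin.ext h2
      simpa
  have hlt2 : ∀ x y, v⁻¹ x < v⁻¹ y → w⁻¹ x < w⁻¹ y := by
    intro x y hv
    rcases lt_trichotomy x y with hxy | rfl | hxy
    · refine lt_of_le_of_ne (not_lt.1 fun h' => ?_) (by simpa using hxy.ne)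
      rw [hlt hxy, ← h, ← hlt hxy] at h'
      exact lt_asymm hv h'
    · exact absurd hv (lt_irrefl _)
    · rwa [hlt hxy, ← h, ← hlt hxy]
  have hm : StrictMono (w⁻¹ * v) := fun x y hxy => hlt2 _ _ (by simpa)
  have : w⁻¹ * v = 1 := by
    have h1 := Subsingleton.elim (hm.orderIsoOfSurjective _ (w⁻¹ * v).surjective)
      (OrderIso.refl (Fin n))
    ext x
    have := congrArg (fun f : Fin n ≃o Fin n => (f x : ℕ)) h1
    simpa using this
  rw [← mul_one w, ← this]
  simp

/-! ### Existence of the boolean core -/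

lemma simpleReflection_comm_wordProd {i : Fin (n - 1)} {u : List (Fin (n - 1))}
    (h : ∀ j ∈ u, i ≠ j ∧ ¬ Adj i j) :
    simpleReflection i * wordProd u = wordProd u * simpleReflection i := by
  induction u with
  | nil => simp
  | cons j u ih =>
    rw [wordProd_cons, ← mul_assoc, simpleReflection_comm (h j (by simp)).1 (h j (by simp)).2,
      mul_assoc, ih fun j hj => h j (by simp [hj]), mul_assoc]

lemma exists_eq_append_of_not_nodup {α : Type*} : ∀ {u : List α}, ¬ u.Nodup →
    ∃ z i x y, u = z ++ i :: (x ++ i :: y) ∧ (x ++ i :: y).Nodup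
  | [], h => absurd List.nodup_nil h
  | a :: u, h => by
    by_cases hu : u.Nodup
    · have : a ∈ u := by by_contra h'; exact h (List.nodup_cons.2 ⟨h', hu⟩)
      obtain ⟨x, y, rfl⟩ := List.append_of_mem this
      exact ⟨[], a, x, y, rfl, hu⟩
    · obtain ⟨z, i, x, y, rfl, h'⟩ := exists_eq_append_of_not_nodup hu
      exact ⟨a :: z, i, x, y, rfl, h'⟩

/-- Take the rightmost letter `i` of `u` that occurs again later. Between its two last occurrences
both neighbours of `i` must appear, since otherwise commutations produce a braid or a cancellation.
-/
lemma BraidFree.exists_nodup_prefix {w : Equiv.Perm (Fin n)} (hw : BraidFree w) :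
    ∀ u v : List (Fin (n - 1)), u ++ v ∈ reducedWords w →
      ∃ u' v', u' ++ v' ∈ reducedWords w ∧ u'.Nodup ∧ ∀ i, i ∈ u' ↔ i ∈ u := by
  intro u
  induction hk : u.length using Nat.strong_induction_on generalizing u with
  | _ k ih =>
  subst hk
  intro v hv
  by_cases hu : u.Nodup
  · exact ⟨u, v, hv, hu, fun _ => Iff.rfl⟩
  obtain ⟨z, i, x, y, rfl, hxy⟩ := exists_eq_append_of_not_nodup hu
  have hd := hxy
  rw [List.nodup_append] at hd
  have hix : i ∉ x := fun h => hd.2.2 i h i (by simp) rfl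
  have hiy : i ∉ y := (List.nodup_cons.1 hd.2.1).1
  have hdis : ∀ q ∈ x, q ∉ y := fun q h h' => hd.2.2 q h q (by simp [h']) rfl
  by_cases hA : ∃ q ∈ x, ∃ q' ∈ x, Adj i q ∧ Adj i q' ∧ q ≠ q'
  · obtain ⟨q, hq, q', hq', h1, h2, hne⟩ := hA
    -- As `x ++ i :: y` has distinct letters and `x` uses up both neighbours of `i`, the last `i`
    -- commutes past `y` into the second factor.
    have hc : simpleReflection i * wordProd y = wordProd y * simpleReflection i := by
      refine simpleReflection_comm_wordProd fun j hj => ⟨?_, fun h3 => ?_⟩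
      · rintro rfl; exact hiy hj
      · have : j = q ∨ j = q' := by
          unfold Adj at h1 h2 h3
          simp only [Fin.ext_iff, ne_eq] at hne ⊢
          omega
        rcases this with rfl | rfl
        · exact hdis _ hq hj
        · exact hdis _ hq' hj
    have e : wordProd (z ++ i :: (x ++ y) ++ i :: v) =
        wordProd (z ++ i :: (x ++ i :: y) ++ v) := by
      simp only [wordProd_append, wordProd_cons, mul_assoc]
      rw [← mul_assoc (wordProd y), ← hc, mul_assoc]
    obtain ⟨u', v', h3, h4, h5⟩ := ih (z ++ i :: (x ++ y)).length (by simp) _ rfl (i :: v)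
      ⟨by rw [e, hv.1], by rw [← hv.2]; simp; omega⟩
    exact ⟨u', v', h3, h4, fun j => by rw [h5]; simp; tauto⟩
  · exfalso
    push Not at hA
    by_cases hB : ∃ q ∈ x, Adj i q
    · obtain ⟨q, hq, hiq⟩ := hB
      obtain ⟨α, β, rfl⟩ := List.append_of_mem hq
      have hn := hd.1
      rw [List.nodup_append] at hn
      have hα : q ∉ α := fun h => hn.2.2 q h q (by simp) rfl
      have hβ : q ∉ β := (List.nodup_cons.1 hn.2.1).1
      have cα : simpleReflection i * wordProd α = wordProd α * simpleReflection i := by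
        refine simpleReflection_comm_wordProd fun j hj => ⟨?_, fun h3 => ?_⟩
        · rintro rfl; exact hix (by simp [hj])
        · exact hα (hA q hq j (by simp [hj]) hiq h3 ▸ hj)
      have cβ : simpleReflection i * wordProd β = wordProd β * simpleReflection i := by
        refine simpleReflection_comm_wordProd fun j hj => ⟨?_, fun h3 => ?_⟩
        · rintro rfl; exact hix (by simp [hj])
        · exact hβ (hA q hq j (by simp [hj]) hiq h3 ▸ hj)
      refine hw (z ++ α) (β ++ y ++ v) i q hiq ⟨?_, ?_⟩
      · rw [← hv.1]
        simp only [wordProd_append, wordProd_cons, mul_assoc]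
        rw [← mul_assoc (simpleReflection i) (wordProd α), cα, mul_assoc,
          ← mul_assoc (simpleReflection i) (wordProd β), cβ, mul_assoc]
      · rw [← hv.2]; simp; omega
    · push Not at hB
      have cx : simpleReflection i * wordProd x = wordProd x * simpleReflection i :=
        simpleReflection_comm_wordProd fun j hj => ⟨by rintro rfl; exact hix hj, hB j hj⟩
      have e : wordProd (z ++ x ++ y ++ v) = w := by
        rw [← hv.1]
        simp only [wordProd_append, wordProd_cons, mul_assoc]
        rw [← mul_assoc (simpleReflection i) (wordProd x), cx, mul_assoc,
          ← mul_assoc (simpleReflection i) (simpleReflection i), simpleReflection_mul_self, one_mul]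
      have := length_wordProd_le (z ++ x ++ y ++ v)
      rw [e, ← hv.2] at this
      simp at this

lemma BraidFree.exists_isBooleanCore {w : Equiv.Perm (Fin n)} (hw : BraidFree w) :
    ∃ c, IsBooleanCore c w := by
  obtain ⟨u, hu⟩ := exists_reduced w
  obtain ⟨x, y, hxy, hx, hm⟩ := hw.exists_nodup_prefix u [] (by simpa using hu)
  have hl : length (wordProd (x ++ y)) = (x ++ y).length := by rw [hxy.1, hxy.2]
  obtain ⟨h1, h2⟩ := reduced_of_append hl
  refine ⟨wordProd x, isBoolean_of_nodup hx, ?_, wordProd y, by rw [← hxy.1, wordProd_append], ?_⟩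
  · ext i
    rw [mem_supp_iff, mem_supp_iff, ← mem_reduced_iff h1, hm, ← hu.1,
      mem_reduced_iff (by rw [hu.1, hu.2])]
  · rw [h1, h2, ← hxy.2, List.length_append]

/-! ### Inversion relations of `321`-avoiding permutations -/

/-- The properties of the inversions of a `321`-avoiding permutation: the values split into lower
entries and upper entries, and each upper entry is related to an interval of lower entries. -/
structure IsInvRel (E : ℕ → ℕ → Prop) : Prop where
  lt : ∀ {b t}, E b t → b < t
  not_both : ∀ {b t u}, E b t → ¬ E t u
  between : ∀ {b t x}, E b t → b < x → x < t → E b x ∨ E x t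
  fill : ∀ {b t b' u t' v}, E b t → E b' u → E v t' → b ≤ b' → t' ≤ t → b' < t' → E b' t'

/-- The pairs related by `E` which do not properly enclose such a pair. -/
def Innermost (E : ℕ → ℕ → Prop) (b t : ℕ) : Prop :=
  E b t ∧ ∀ b' t', b < b' → t' < t → ¬ E b' t'

/-- Every cut crossed by `E` is crossed by a subrelation `F` without nestings: then `F` consists of
the innermost pairs of `E`. -/
lemma innermost_iff_of_crossing {E F : ℕ → ℕ → Prop} (hE : IsInvRel E) (hF : IsInvRel F)
    (hFE : ∀ {b t}, F b t → E b t)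
    (hcut : ∀ {i b t}, E b t → b < i → i ≤ t → ∃ b' t', F b' t' ∧ b' < i ∧ i ≤ t')
    (hnest : ∀ {b t b' t'}, F b t → b < b' → t' < t → ¬ F b' t') {b t : ℕ} :
    F b t ↔ Innermost E b t := by
  -- The cut just above `x` is crossed by `F`; as `x` is no upper entry, `between` makes it a lower
  -- entry of `F`. The dual argument gives `hup`.
  have hlow {x u : ℕ} (h : E x u) : ∃ u, F x u := by
    obtain ⟨b', t', h1, h2, h3⟩ := hcut h (Nat.lt_succ_self x) (hE.lt h)
    rcases (Nat.lt_succ_iff.1 h2).eq_or_lt with rfl | h2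
    · exact ⟨_, h1⟩
    · rcases hF.between h1 h2 h3 with h4 | h4
      · exact absurd h (hE.not_both (hFE h4))
      · exact ⟨_, h4⟩
  have hup {x v : ℕ} (h : E v x) : ∃ v, F v x := by
    obtain ⟨b', t', h1, h2, h3⟩ := hcut h (hE.lt h) le_rfl
    rcases h3.eq_or_lt with rfl | h3
    · exact ⟨_, h1⟩
    · rcases hF.between h1 h2 h3 with h4 | h4
      · exact ⟨_, h4⟩
      · exact absurd (hFE h4) (hE.not_both h)
  constructor
  · refine fun h => ⟨hFE h, fun b' t' hb ht h' => ?_⟩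
    obtain ⟨u, hu⟩ := hlow h'
    obtain ⟨v, hv⟩ := hup h'
    exact hnest h hb ht (hF.fill h hu hv hb.le ht.le (hE.lt h'))
  · rintro ⟨h, hmin⟩
    by_contra hn
    have hbt := hE.lt h
    have hlt {x : ℕ} (hx : F b x) : x < t := by
      obtain ⟨v, hv⟩ := hup h
      by_contra hc
      exact hn (hF.fill hx hx hv le_rfl (not_lt.1 hc) hbt)
    have hmax : ∃ s, F b s ∧ ∀ x, F b x → x ≤ s := by
      classical
      obtain ⟨u, hu⟩ := hlow h
      exact ⟨Nat.findGreatest (F b) t, Nat.findGreatest_spec (hlt hu).le hu,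
        fun x hx => Nat.le_findGreatest (hlt hx).le hx⟩
    obtain ⟨s, hs, hsm⟩ := hmax
    have hst := hlt hs
    have hbs := hF.lt hs
    -- With `s` the largest `F`-partner of `b`, the pair of `F` crossing the cut above `s` starts
    -- after `b`. Then `(b', t')` or `(b', s)` is nested inside `(b, t)`.
    obtain ⟨b', t', h1, h2, h3⟩ := hcut (i := s + 1) h (by omega) hst
    have hbb : b < b' := by
      by_contra hc
      have := hsm _ (hF.fill h1 hs h1 (not_lt.1 hc) le_rfl (by omega))
      omega
    rcases lt_or_ge t' t with h4 | h4
    · exact hmin _ _ hbb h4 (hFE h1)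
    · have hne : b' ≠ s := by rintro rfl; exact hF.not_both hs h1
      exact hmin _ _ hbb hst (hE.fill h (hFE h1) (hFE hs) hbb.le hst.le (by omega))

lemma Inv.lt {w : Equiv.Perm (Fin n)} {b t : ℕ} (h : Inv w b t) : b < t := by
  obtain ⟨i, j, _, h, rfl, rfl⟩ := h
  exact h

lemma Avoids321.upper_lt {w : Equiv.Perm (Fin n)} (hw : Avoids321 w) {i j k : Fin n}
    (hij : i < j) (hji : w j < w i) (hik : w i < w k) : i < k := by
  by_contra h
  exact hw k i j (lt_of_le_of_ne (not_lt.1 h) (by rintro rfl; exact lt_irrefl _ hik)) hij hji hik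

lemma Avoids321.lower_lt {w : Equiv.Perm (Fin n)} (hw : Avoids321 w) {i j k : Fin n}
    (hij : i < j) (hji : w j < w i) (hjk : w k < w j) : k < j := by
  by_contra h
  exact hw i j k hij (lt_of_le_of_ne (not_lt.1 h) (by rintro rfl; exact lt_irrefl _ hjk)) hjk hji

lemma Avoids321.isInvRel {w : Equiv.Perm (Fin n)} (hw : Avoids321 w) : IsInvRel (Inv w) where
  lt := Inv.lt
  not_both := by
    rintro b t u ⟨i, j, hij, hlt, rfl, rfl⟩ ⟨i', j', hij', hlt', h, rfl⟩
    obtain rfl := w.injective (Fin.ext h)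
    exact hw _ _ _ hij' hij hlt hlt'
  between := by
    rintro b t x ⟨i, j, hij, hlt, rfl, rfl⟩ h1 h2
    have hx : x < n := h2.trans (w i).2
    obtain ⟨k, hk⟩ := w.surjective ⟨x, hx⟩
    have hk' : x = w k := by rw [hk]
    subst hk'
    rcases lt_or_ge k j with h | h
    · exact .inl ⟨k, j, h, h1, rfl, rfl⟩
    · exact .inr ⟨i, k, hij.trans_le h, h2, rfl, rfl⟩
  fill := by
    rintro b t b' u t' v ⟨i, j, hij, hlt, rfl, rfl⟩ ⟨i1, j1, hij1, hlt1, rfl, rfl⟩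
      ⟨i2, j2, hij2, hlt2, rfl, rfl⟩ h1 h2 h3
    refine ⟨i2, j1, ?_, h3, rfl, rfl⟩
    have h4 : i2 ≤ i := by
      rcases h2.eq_or_lt with h2 | h2
      · exact (w.injective (Fin.ext h2)).le
      · exact (hw.upper_lt hij2 hlt2 h2).le
    have h5 : j ≤ j1 := by
      rcases h1.eq_or_lt with h1 | h1
      · exact (w.injective (Fin.ext h1)).le
      · exact (hw.lower_lt hij1 hlt1 h1).le
    exact h4.trans_lt (hij.trans_le h5)

/-- If some point goes up across the cut, then by finiteness another goes down, and the two form an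
inversion. -/
lemma fixes_iff (w : Equiv.Perm (Fin n)) (i : ℕ) :
    ¬ Fixes i w ↔ ∃ b t, Inv w b t ∧ b < i ∧ i ≤ t := by
  constructor
  · intro h
    have h' : ¬ ∀ a : Fin n, i ≤ a → i ≤ (w a : ℕ) := by
      intro h'
      apply h
      have h1 : Fixes i w⁻¹ := by
        intro a ha
        by_contra hc
        have := h' _ (not_lt.1 hc)
        simp at this
        omega
      simpa using h1.inv
    unfold Fixes at h
    push Not at h h'
    obtain ⟨a, ha, ha'⟩ := h
    obtain ⟨c, hc, hc'⟩ := h'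
    exact ⟨_, _, ⟨a, c, Fin.lt_def.2 (by omega), Fin.lt_def.2 (by omega), rfl, rfl⟩, hc', ha'⟩
  · rintro ⟨b, t, ⟨i', j, hij, hlt, rfl, rfl⟩, h1, h2⟩ h
    have h3 := h.inv (w j) h1
    rw [Equiv.Perm.inv_def, Equiv.symm_apply_apply] at h3
    have := h i' (lt_trans hij h3)
    omega

/-! ### Crossings of a cut by a boolean permutation -/

/-- The points below the cut `i` which `w` sends above it. -/
def crossings (i : ℕ) (w : Equiv.Perm (Fin n)) : Finset (Fin n) :=
  Finset.univ.filter fun a => (a : ℕ) < i ∧ i ≤ w a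

lemma mem_crossings {i : ℕ} {w : Equiv.Perm (Fin n)} {a : Fin n} :
    a ∈ crossings i w ↔ (a : ℕ) < i ∧ i ≤ w a := by simp [crossings]

/-- Only the cut between the two exchanged values can gain a crossing, and only at the point sent to
the lower of them. -/
lemma card_crossings_mul_le (i : ℕ) (j : Fin (n - 1)) (w : Equiv.Perm (Fin n)) :
    (crossings i (simpleReflection j * w)).card ≤
      (crossings i w).card + if i = j + 1 then 1 else 0 := by
  split_ifs with h
  · refine (Finset.card_le_card (t := insert (w⁻¹ (lo j)) (crossings i w)) ?_).trans
      (Finset.card_insert_le _ _)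
    intro a ha
    simp only [mem_crossings, Finset.mem_insert, Equiv.Perm.mul_apply] at ha ⊢
    by_cases h1 : w a = lo j
    · left; rw [← h1]; simp
    · right
      refine ⟨ha.1, ?_⟩
      by_cases h2 : w a = hi j
      · rw [h2]; simp [h]
      · have := ha.2
        rwa [simpleReflection, Equiv.swap_apply_of_ne_of_ne h1 h2] at this
  · refine (Finset.card_le_card fun a ha => ?_).trans (Nat.le_add_right _ _)
    simp only [mem_crossings, Equiv.Perm.mul_apply] at ha ⊢
    refine ⟨ha.1, ?_⟩
    by_contra hc
    have := fixes_simpleReflection h (w a) (not_le.1 hc)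
    omega

lemma card_crossings_le_one {u : List (Fin (n - 1))} (hu : u.Nodup) (i : ℕ) :
    (crossings i (wordProd u)).card ≤ 1 := by
  have key : ∀ u : List (Fin (n - 1)), (crossings i (wordProd u)).card ≤
      u.countP fun j : Fin (n - 1) => i = (j : ℕ) + 1 := by
    intro u
    induction u with
    | nil =>
      refine (Finset.card_eq_zero.2 (Finset.eq_empty_of_forall_notMem fun a ha => ?_)).le
      have := mem_crossings.1 ha
      simp at this
      omega
    | cons j u ih =>
      have := card_crossings_mul_le i j (wordProd u)
      rw [wordProd_cons, List.countP_cons]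
      simp only [decide_eq_true_eq]
      omega
  refine (key u).trans ?_
  by_cases hi : ∃ j ∈ u, i = (j : ℕ) + 1
  · obtain ⟨j, _, rfl⟩ := hi
    have : (u.countP fun j' : Fin (n - 1) => decide ((j : ℕ) + 1 = (j' : ℕ) + 1)) = u.count j := by
      rw [List.count]
      refine List.countP_congr fun x _ => ?_
      simp only [decide_eq_true_eq, beq_iff_eq, Fin.ext_iff]
      omega
    rw [this]
    exact List.nodup_iff_count_le_one.1 hu j
  · push Not at hi
    rw [List.countP_eq_zero.2 (by simpa using hi)]
    exact zero_le_one

/-- At most one value goes up, and at most one goes down, across each cut. -/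
def ThinCuts (c : Equiv.Perm (Fin n)) : Prop :=
  (∀ (i : ℕ) (a b : Fin n), (a : ℕ) < i → (b : ℕ) < i → i ≤ c a → i ≤ c b → a = b) ∧
  ∀ (i : ℕ) (a b : Fin n), i ≤ (a : ℕ) → i ≤ (b : ℕ) → (c a : ℕ) < i → (c b : ℕ) < i → a = b

lemma wordProd_reverse (u : List (Fin (n - 1))) : wordProd u.reverse = (wordProd u)⁻¹ := by
  induction u with
  | nil => simp
  | cons i u ih =>
    rw [List.reverse_cons, wordProd_append, ih, wordProd_cons, wordProd_cons, mul_inv_rev]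
    simp [simpleReflection]

lemma IsBoolean.thinCuts {c : Equiv.Perm (Fin n)} (h : IsBoolean c) : ThinCuts c := by
  obtain ⟨u, rfl, hu⟩ := exists_reduced c
  have hn := nodup_of_isBoolean hu.symm h
  constructor
  · intro i a b ha hb ha' hb'
    exact Finset.card_le_one.1 (card_crossings_le_one hn i) a (by simp [mem_crossings, *])
      b (by simp [mem_crossings, *])
  · intro i a b ha hb ha' hb'
    have h1 := card_crossings_le_one (List.nodup_reverse.2 hn) i
    rw [wordProd_reverse] at h1
    apply (wordProd u).injective
    exact Finset.card_le_one.1 h1 _ (by simp [mem_crossings, *]) _ (by simp [mem_crossings, *])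

/-- Nesting forces the positions `i' < i < j < j'`. At the cut `t' = c i'`, either `i'` and `i` both
go up or `j` and `j'` both go down. -/
lemma ThinCuts.not_nested {c : Equiv.Perm (Fin n)} (h : ThinCuts c) (hc : Avoids321 c)
    {b t b' t' : ℕ} (hbt : Inv c b t) (hb : b < b') (ht : t' < t) : ¬ Inv c b' t' := by
  intro h'
  have hlt := h'.lt
  obtain ⟨i, j, hij, hji, rfl, rfl⟩ := hbt
  obtain ⟨i', j', hij', hji', rfl, rfl⟩ := h'
  have h1 := hc.upper_lt hij' hji' ht
  have h2 := hc.lower_lt hij' hji' hb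
  rw [Fin.lt_def] at *
  rcases lt_or_ge (i : ℕ) (c i') with h3 | h3
  · have := h.1 (c i') i i' h3 (by omega) (by omega) le_rfl
    subst this; omega
  · have := h.2 (c i') j j' (by omega) (by omega) (by omega) (by omega)
    subst this; omega

/-! ### The inversions of a core, and its uniqueness. -/

lemma IsBooleanCore.avoids321 {c w : Equiv.Perm (Fin n)} (h : IsBooleanCore c w)
    (hw : Avoids321 w) : Avoids321 c := by
  obtain ⟨_, _, v, rfl, hl⟩ := h
  intro i j k hij hjk hkj hji
  exact hw.isInvRel.not_both (Inv.mul hl ⟨j, k, hjk, hkj, rfl, rfl⟩)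
    (Inv.mul hl ⟨i, j, hij, hji, rfl, rfl⟩)

lemma IsBooleanCore.inv_iff {c w : Equiv.Perm (Fin n)} (h : IsBooleanCore c w)
    (hw : Avoids321 w) (b t : ℕ) : Inv c b t ↔ Innermost (Inv w) b t := by
  have hc := h.avoids321 hw
  have ht := h.1.thinCuts
  refine innermost_iff_of_crossing hw.isInvRel hc.isInvRel ?_ ?_ (ht.not_nested hc)
  · obtain ⟨_, _, v, rfl, hl⟩ := h
    exact Inv.mul hl
  · intro i b t hbt hb hi
    have hin : i < n := by
      obtain ⟨_, _, _, _, _, rfl⟩ := hbt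
      exact hi.trans_lt (Fin.is_lt _)
    -- The zero-based letter `i - 1` belongs to the cut after the first `i` points.
    have hs := Set.ext_iff.1 h.2.1 ⟨i - 1, by omega⟩
    simp only [mem_supp_iff] at hs
    rw [Nat.sub_add_cancel (by omega), fixes_iff, fixes_iff] at hs
    exact hs.2 ⟨b, t, hbt, hb, hi⟩

lemma IsBooleanCore.unique {c c' w : Equiv.Perm (Fin n)} (h : IsBooleanCore c w)
    (h' : IsBooleanCore c' w) (hw : Avoids321 w) : c = c' :=
  eq_of_inv_iff fun b t => by rw [h.inv_iff hw, h'.inv_iff hw]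

/-! ### Stable matchings of inversion relations -/

/-- `M` is a matching in `E` such that each pair of `E` has an entry which `M` matches with an entry
at most as large as its partner in the pair. -/
structure IsStable (E M : ℕ → ℕ → Prop) : Prop where
  sub : ∀ {b t}, M b t → E b t
  left_unique : ∀ {b t t'}, M b t → M b t' → t = t'
  right_unique : ∀ {b b' t}, M b t → M b' t → b = b'
  stable : ∀ {b t}, E b t → (∃ t' ≤ t, M b t') ∨ ∃ b' ≤ b, M b' t

/-- The upper entries matched by `M`. -/
def tops (M : ℕ → ℕ → Prop) : Set ℕ := {t | ∃ b, M b t}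

section Compare

variable {E M N : ℕ → ℕ → Prop}

/-- Descent on `a`: `N` matches `h` from below `a`, while `M` does not. Stability of `M` makes `a -
1` an upper entry. As `(b, h)` is innermost and `N` is stable, `N` matches `a - 1` from below `b`,
and innermostness gives `b = a - 2`. The same configuration recurs with `b`, `b + 1` in place of
`a`, `h`. -/
lemma false_of_innermost_stable (hE : IsInvRel E) (hM : IsStable E M)
    (hN : IsStable (Innermost E) N) (a : ℕ) : ∀ h b, (h = a ∨ (h = a + 1 ∧ ∃ s, E a s)) →
      (∀ b', M b' h → a ≤ b') → N b h → b < a → False := by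
  induction a using Nat.strong_induction_on with
  | _ a ih =>
  intro h b hh hMh hNb hba
  have ha : ∀ s, h ≠ a → ¬ E s a := by
    intro s hne hs
    rcases hh with hh | ⟨_, u, hu⟩
    · exact hne hh
    · exact hE.not_both hs hu
  have hle : a ≤ h ∧ h ≤ a + 1 := by omega
  have hbh := hN.sub hNb
  have h1 : ∀ s, ¬ E (a - 1) s := by
    intro s hs
    have h2 : E (a - 1) h := hE.fill hbh.1 hs hbh.1 (by omega) le_rfl (by omega)
    rcases hM.stable h2 with ⟨t', ht, h3⟩ | ⟨b', hb, h3⟩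
    · have h4 := hE.lt (hM.sub h3)
      rcases eq_or_ne t' h with rfl | h5
      · have := hMh _ h3; omega
      · have : t' = a := by omega
        subst this
        exact ha _ h5.symm (hM.sub h3)
    · have := hMh _ h3; omega
  have hb1 : b < a - 1 := by
    have : b ≠ a - 1 := by rintro rfl; exact h1 _ hbh.1
    omega
  have h2 : E b (a - 1) := (hE.between hbh.1 hb1 (by omega)).resolve_right (h1 _)
  have h3 : ∀ x s, b < x → x < a - 1 → ¬ E x s := fun x s hx hx' hs =>
    hbh.2 x (a - 1) hx (by omega) (hE.fill hbh.1 hs h2 hx.le (by omega) hx')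
  have h4 : Innermost E b (a - 1) := by
    refine ⟨h2, fun b' t' hb ht h' => h3 b' t' hb ?_ h'⟩
    have := hE.lt h'
    omega
  obtain ⟨b', hb', h5⟩ : ∃ b' < b, N b' (a - 1) := by
    rcases hN.stable h4 with ⟨t', ht, h5⟩ | ⟨b', hb, h5⟩
    · have := hN.left_unique h5 hNb; omega
    · refine ⟨b', lt_of_le_of_ne hb ?_, h5⟩
      rintro rfl
      have := hN.left_unique h5 hNb; omega
  have h6 : b = a - 2 := by
    by_contra hne
    refine (hN.sub h5).2 b (a - 2) hb' (by omega) ?_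
    exact (hE.between hbh.1 (x := a - 2) (by omega) (by omega)).resolve_right
      (h3 _ _ (by omega) (by omega))
  refine ih b (by omega) (b + 1) b' (.inr ⟨rfl, _, hbh.1⟩) ?_ ?_ hb'
  · intro b'' hb''
    -- Stability at `(b, h)` forces `M b (b + 1)`: the partner of `b` is neither `h` nor `a`.
    rcases hM.stable hbh.1 with ⟨t', ht, h7⟩ | ⟨c, hc, h7⟩
    · have h8 := hE.lt (hM.sub h7)
      have h9 : t' ≠ h := by
        rintro rfl
        have := hMh _ h7; omega
      have h10 : t' ≠ a := by
        rintro rfl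
        exact ha _ h9.symm (hM.sub h7)
      have : t' = b + 1 := by omega
      subst this
      exact (hM.right_unique h7 hb'').le
    · have := hMh _ h7; omega
  · rwa [show b + 1 = a - 1 by omega]

lemma tops_innermost_subset (hE : IsInvRel E) (hM : IsStable E M)
    (hN : IsStable (Innermost E) N) : tops N ⊆ tops M := by
  rintro k ⟨b, hb⟩
  by_contra hk
  exact false_of_innermost_stable hE hM hN k k b (.inl rfl) (fun b' hb' => absurd ⟨b', hb'⟩ hk) hb
    (hE.lt (hN.sub hb).1)

/-- If the upper entry `x` were unmatched, `(b, x)` would be a blocking pair, as `b` prefers `x` to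
`t`. -/
lemma IsStable.mem_tops_of_lt (hE : IsInvRel E) (hM : IsStable E M) {b t v x : ℕ} (h : M b t)
    (hv : E v x) (hb : b < x) (hx : x < t) : x ∈ tops M := by
  rcases hM.stable (hE.fill (hM.sub h) (hM.sub h) hv le_rfl hx.le hb) with ⟨t', ht, h'⟩ | ⟨b', _, h'⟩
  · have := hM.left_unique h h'; omega
  · exact ⟨b', h'⟩

open Classical in
/-- The number of elements of `S` in the interval `[a, k]`. -/
noncomputable def countIcc (S : Set ℕ) (a k : ℕ) : ℕ := ((Finset.Icc a k).filter (· ∈ S)).card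

lemma countIcc_succ_le {S : Set ℕ} {a k : ℕ} (h : a ∈ S) (hk : a ≤ k) :
    countIcc S (a + 1) k + 1 ≤ countIcc S a k := by
  classical
  unfold countIcc
  rw [← Finset.card_insert_of_notMem (a := a) (by simp)]
  refine Finset.card_le_card fun x hx => ?_
  simp only [Finset.mem_insert, Finset.mem_filter, Finset.mem_Icc] at hx ⊢
  rcases hx with rfl | ⟨hx, hx'⟩
  · exact ⟨⟨le_rfl, hk⟩, h⟩
  · exact ⟨⟨by omega, hx.2⟩, hx'⟩

lemma countIcc_mono {S : Set ℕ} {a a' k : ℕ} (h : a' ≤ a) : countIcc S a k ≤ countIcc S a' k := by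
  classical
  exact Finset.card_le_card (Finset.filter_subset_filter _ (Finset.Icc_subset_Icc_left h))

/-- Descent with the roles exchanged: now `N` does not match `h` from below `a`, while a pair of `M`
crosses the cut at `a`. Each round adds two values to the window `[a, k]` and at least one matched
upper entry, so the count stays at the largest permitted value. It cannot be exceeded, hence `a - 2`
must be a lower entry and the descent goes on. -/
lemma false_of_uncrowded (hE : IsInvRel E) (hM : IsStable E M) (hN : IsStable (Innermost E) N)
    (hU : ∀ a x, 0 < x → countIcc (tops M) a (a + 2 * x) ≤ x + 1) (a : ℕ) :
    ∀ h j k v, (h = a ∨ (h = a + 1 ∧ ∃ s, E a s)) → E v h → (∀ b', N b' h → a ≤ b') →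
      (∃ b t, M b t ∧ b < a ∧ a ≤ t) → k = a + 2 * j → j + 1 ≤ countIcc (tops M) a k → False := by
  induction a using Nat.strong_induction_on with
  | _ a ih =>
  rintro h j k v hh hv hNh ⟨b, t, hbt, hba, hat⟩ hk hcount
  have ha : ∀ s, h ≠ a → ¬ E s a := by
    intro s hne hs
    rcases hh with hh | ⟨_, u, hu⟩
    · exact hne hh
    · exact hE.not_both hs hu
  have hle : a ≤ h ∧ h ≤ a + 1 := by omega
  have hbE := hM.sub hbt
  have hbh : E b h := by
    refine hE.fill hbE hbE hv le_rfl ?_ (by omega)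
    by_contra hc
    have : t = a := by omega
    subst this
    exact ha _ (by omega) hbE
  have h1 : ∀ s, ¬ E (a - 1) s := by
    intro s hs
    have h2 : E (a - 1) h := hE.fill hbh hs hv (by omega) le_rfl (by omega)
    have h3 : Innermost E (a - 1) h := by
      refine ⟨h2, fun b' t' hb ht h' => ?_⟩
      have := hE.lt h'; omega
    rcases hN.stable h3 with ⟨t', ht, h6⟩ | ⟨b', hb, h6⟩
    · have h4 := hE.lt (hN.sub h6).1
      rcases eq_or_ne t' h with rfl | h5
      · have := hNh _ h6; omega
      · have : t' = a := by omega
        subst this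
        exact ha _ h5.symm (hN.sub h6).1
    · have := hNh _ h6; omega
  have hb1 : b < a - 1 := by
    have : b ≠ a - 1 := by rintro rfl; exact h1 _ hbh
    omega
  have h2 : E b (a - 1) := (hE.between hbh hb1 (by omega)).resolve_right (h1 _)
  have h3 : a - 1 ∈ tops M := hM.mem_tops_of_lt hE hbt h2 hb1 (by omega)
  have hc1 : j + 2 ≤ countIcc (tops M) (a - 1) k := by
    have := countIcc_succ_le (k := k) h3 (by omega)
    rw [Nat.sub_add_cancel (by omega)] at this
    omega
  by_cases hlow : ∃ s, E (a - 2) s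
  · obtain ⟨s, hs⟩ := hlow
    have h4 : Innermost E (a - 2) h := by
      refine ⟨hE.fill hbh hs hv (by omega) le_rfl (by omega), fun b' t' hb ht h' => ?_⟩
      have := hE.lt h'
      have : b' = a - 1 := by omega
      subst this
      exact h1 _ h'
    have h5 : N (a - 2) (a - 1) := by
      rcases hN.stable h4 with ⟨t', ht, h5⟩ | ⟨b', hb, h5⟩
      · have h6 := hE.lt (hN.sub h5).1
        have h7 : t' ≠ h := by
          rintro rfl
          have := hNh _ h5; omega
        have h8 : t' ≠ a := by
          rintro rfl
          exact ha _ h7.symm (hN.sub h5).1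
        have : t' = a - 1 := by omega
        rwa [this] at h5
      · have := hNh _ h5; omega
    refine ih (a - 2) (by omega) (a - 1) (j + 1) k b (.inr ⟨by omega, s, hs⟩) h2 ?_ ?_ (by omega)
      (hc1.trans (countIcc_mono (by omega)))
    · exact fun b' hb' => (hN.right_unique h5 hb').le
    -- If the crossing pair starts at `a - 2`, it no longer crosses the new cut; the pair of `M`
    -- ending at `a - 1` replaces it.
    · rcases eq_or_ne b (a - 2) with h6 | h6
      · obtain ⟨b', hb'⟩ := h3
        have h7 := hE.lt (hM.sub hb')
        refine ⟨b', a - 1, hb', ?_, by omega⟩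
        have : b' ≠ a - 2 := by
          rintro rfl
          rw [h6] at hbt
          have := hM.left_unique hbt hb'; omega
        omega
      · exact ⟨b, t, hbt, by omega, by omega⟩
  · push Not at hlow
    have hb2 : b < a - 2 := by
      have : b ≠ a - 2 := by rintro rfl; exact hlow _ hbh
      omega
    have h4 : E b (a - 2) := (hE.between hbh hb2 (by omega)).resolve_right (hlow _)
    have h5 : a - 2 ∈ tops M := hM.mem_tops_of_lt hE hbt h4 hb2 (by omega)
    have h6 := countIcc_succ_le (k := k) h5 (by omega)
    rw [show a - 2 + 1 = a - 1 by omega] at h6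
    -- Both `a - 1` and `a - 2` are now matched upper entries, so `[a - 2, k]` holds at least `j +
    -- 3` of them, against the bound `j + 2`.
    have h7 := hU (a - 2) (j + 1) (by omega)
    rw [show a - 2 + 2 * (j + 1) = k by omega] at h7
    omega

lemma tops_innermost_eq (hE : IsInvRel E) (hM : IsStable E M) (hN : IsStable (Innermost E) N)
    (hU : ∀ a x, 0 < x → countIcc (tops M) a (a + 2 * x) ≤ x + 1) : tops N = tops M := by
  refine (tops_innermost_subset hE hM hN).antisymm ?_
  rintro k ⟨b, hb⟩
  by_contra hk
  refine false_of_uncrowded hE hM hN hU k k 0 k b (.inl rfl) (hM.sub hb)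
    (fun b' hb' => absurd ⟨b', hb'⟩ hk) ⟨b, k, hb, hE.lt (hM.sub hb), le_rfl⟩ rfl ?_
  have : k ∈ tops M := ⟨b, hb⟩
  simp [countIcc, this, Finset.filter_singleton]

/-- A matching with at most two pairs across each cut has uncrowded upper entries. -/
lemma countIcc_tops_le (hE : IsInvRel E) (hM : IsStable E M)
    (hcross : ∀ y (K : Finset ℕ), (∀ t ∈ K, ∃ b, M b t ∧ b < y ∧ y ≤ t) → K.card ≤ 2) (a x : ℕ) :
    countIcc (tops M) a (a + 2 * x) ≤ x + 1 := by
  classical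
  unfold countIcc
  set K := (Finset.Icc a (a + 2 * x)).filter (· ∈ tops M) with hK
  have hmem : ∀ t ∈ K, (a ≤ t ∧ t ≤ a + 2 * x) ∧ ∃ b, M b t := by
    intro t ht
    rw [hK, Finset.mem_filter, Finset.mem_Icc] at ht
    exact ht
  -- At most two elements of `K` have partners below `a`. The other partners lie in the window,
  -- disjoint from `K`, so `2 |K| - 2 ≤ 2 x + 1`.
  have hsplit := Finset.card_filter_add_card_filter_not (s := K) fun t => ∃ b, M b t ∧ b < a
  have h1 := hcross a (K.filter fun t => ∃ b, M b t ∧ b < a) (by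
    intro t ht
    rw [Finset.mem_filter] at ht
    obtain ⟨b, h1, h2⟩ := ht.2
    exact ⟨b, h1, h2, (hmem t ht.1).1.1⟩)
  set I := K.filter fun t => ¬ ∃ b, M b t ∧ b < a with hI
  have hf : ∀ t ∈ I, ∃ b, M b t ∧ a ≤ b := by
    intro t ht
    rw [hI, Finset.mem_filter] at ht
    obtain ⟨b, hb⟩ := (hmem t ht.1).2
    exact ⟨b, hb, not_lt.1 fun h => ht.2 ⟨b, hb, h⟩⟩
  choose! f hf using hf
  have h2 : (I.image f).card = I.card := Finset.card_image_of_injOn fun t ht t' ht' h =>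
    hM.left_unique (hf t ht).1 (h ▸ (hf t' ht').1)
  have h3 : Disjoint K (I.image f) := by
    rw [Finset.disjoint_left]
    intro t ht ht'
    obtain ⟨s, hs, rfl⟩ := Finset.mem_image.1 ht'
    obtain ⟨b, hb⟩ := (hmem _ ht).2
    exact hE.not_both (hM.sub hb) (hM.sub (hf s hs).1)
  have h4 : (K ∪ I.image f).card ≤ 2 * x + 1 := by
    have : K ∪ I.image f ⊆ Finset.Icc a (a + 2 * x) := by
      refine Finset.union_subset (Finset.filter_subset _ _) fun b hb => ?_
      obtain ⟨s, hs, rfl⟩ := Finset.mem_image.1 hb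
      have h5 := hmem s (Finset.mem_filter.1 hs).1
      have h6 := hE.lt (hM.sub (hf s hs).1)
      exact Finset.mem_Icc.2 ⟨(hf s hs).2, by omega⟩
    refine (Finset.card_le_card this).trans ?_
    rw [Nat.card_Icc]; omega
  rw [Finset.card_union_of_disjoint h3] at h4
  omega

end Compare

/-! ### Uncrowdedness for zero-based entries. -/

lemma isUncrowdedSet_iff (S : Set ℕ) : IsUncrowdedSet {z | ∃ t ∈ S, ((t : ℤ) + 1) = z} ↔
    ∀ a x, 0 < x → countIcc S a (a + 2 * x) ≤ x + 1 := by
  classical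
  have key : ∀ a x : ℕ, (Set.Icc ((a : ℤ) + 1) (a + 1 + 2 * x) ∩
      {z | ∃ t ∈ S, ((t : ℤ) + 1) = z}).ncard = countIcc S a (a + 2 * x) := by
    intro a x
    have hinj : Function.Injective fun t : ℕ => (t : ℤ) + 1 := fun s t h => by simpa using h
    rw [countIcc, ← Finset.card_image_of_injective _ hinj, ← Set.ncard_coe_finset]
    congr 1
    ext z
    simp only [Set.mem_inter_iff, Set.mem_Icc, Set.mem_ofPred_eq, Finset.coe_image,
      Finset.coe_filter, Finset.mem_Icc, Set.mem_image]
    constructor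
    · rintro ⟨h, t, ht, rfl⟩
      exact ⟨t, ⟨by omega, ht⟩, rfl⟩
    · rintro ⟨t, ⟨h, ht⟩, rfl⟩
      exact ⟨by omega, t, ht, rfl⟩
  constructor
  · intro h a x hx
    have := h x (a + 1) (by omega)
    rw [key] at this
    omega
  · intro h x y hx
    lift x to ℕ using hx.le
    -- Windows starting below `1` are moved up to start at `1`, which loses no entries.
    have h1 := h (y - 1).toNat x (by omega)
    rw [← key] at h1
    refine le_trans ?_ (by exact_mod_cast h1 : ((_ : ℕ) : ℤ) ≤ (x : ℤ) + 1)
    refine Nat.cast_le.2 (Set.ncard_le_ncard ?_ ((Set.finite_Icc _ _).inter_of_left _))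
    rintro z ⟨⟨h2, h3⟩, t, ht, rfl⟩
    exact ⟨⟨by omega, by omega⟩, t, ht, rfl⟩

/-! ### Row insertion into two-rowed tableaux -/

lemma rowInsert_of_forall_lt : ∀ {r : List ℕ} {x : ℕ}, (∀ a ∈ r, a < x) →
    rowInsert r x = (r ++ [x], none)
  | [], _, _ => rfl
  | a :: r, x, h => by
    have := h a (by simp)
    rw [rowInsert, if_neg (by omega), rowInsert_of_forall_lt fun b hb => h b (by simp [hb])]
    rfl

lemma rowInsert_spec : ∀ {r : List ℕ} {x : ℕ}, r.Pairwise (· < ·) → x ∉ r →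
    (∀ a ∈ r, a < x) ∨ ∃ z r', rowInsert r x = (r', some z) ∧ z ∈ r ∧ x < z ∧
      (∀ a ∈ r, x < a → z ≤ a) ∧ r'.Pairwise (· < ·) ∧ ∀ a, a ∈ r' ↔ a = x ∨ (a ∈ r ∧ a ≠ z)
  | [], x, _, _ => .inl (by simp)
  | a :: r, x, hr, hx => by
    rw [List.pairwise_cons] at hr
    simp only [List.mem_cons, not_or] at hx
    by_cases hxa : x < a
    · refine .inr ⟨a, x :: r, by rw [rowInsert, if_pos hxa], by simp, hxa, ?_, ?_, ?_⟩
      · intro c hc _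
        rcases List.mem_cons.1 hc with rfl | hc
        · exact le_rfl
        · exact (hr.1 c hc).le
      · exact List.pairwise_cons.2 ⟨fun c hc => hxa.trans (hr.1 c hc), hr.2⟩
      · intro c
        have : c ∈ r → c ≠ a := fun hc => (hr.1 c hc).ne'
        simp only [List.mem_cons]
        tauto
    · rcases rowInsert_spec hr.2 hx.2 with h | ⟨z, r', h1, h2, h3, h4, h5, h6⟩
      · left
        intro c hc
        rcases List.mem_cons.1 hc with rfl | hc
        · omega
        · exact h c hc
      · refine .inr ⟨z, a :: r', by rw [rowInsert, if_neg hxa, h1], by simp [h2], h3, ?_, ?_, ?_⟩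
        · intro c hc hxc
          rcases List.mem_cons.1 hc with rfl | hc
          · exact absurd hxc hxa
          · exact h4 c hc hxc
        · refine List.pairwise_cons.2 ⟨fun c hc => ?_, h5⟩
          rcases (h6 c).1 hc with rfl | hc
          · omega
          · exact hr.1 c hc.1
        · intro c
          have : c = a → c ≠ z := by rintro rfl; exact (hr.1 z h2).ne
          simp only [List.mem_cons, h6]
          tauto

/-- The tableau with the given rows, without its empty rows. -/
def twoRows : List ℕ → List ℕ → List (List ℕ)
  | [], _ => []
  | a :: r, [] => [a :: r]
  | a :: r, b :: s => [a :: r, b :: s]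

lemma tableauInsert_twoRows_append {r s : List ℕ} {x : ℕ} (h : ∀ a ∈ r, a < x)
    (hs : r = [] → s = []) : tableauInsert (twoRows r s) x = twoRows (r ++ [x]) s := by
  rcases r with _ | ⟨a, r⟩
  · rw [hs rfl]; rfl
  · rcases s with _ | ⟨b, s⟩ <;> simp [twoRows, tableauInsert, rowInsert_of_forall_lt h]

lemma tableauInsert_twoRows_bump {r r' s : List ℕ} {x z : ℕ} (h : rowInsert r x = (r', some z))
    (hr : r ≠ []) (hr' : r' ≠ []) (hs : ∀ a ∈ s, a < z) :
    tableauInsert (twoRows r s) x = twoRows r' (s ++ [z]) := by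
  rcases r with _ | ⟨a, r⟩
  · exact absurd rfl hr
  rcases r' with _ | ⟨a', r'⟩
  · exact absurd rfl hr'
  rcases s with _ | ⟨b, s⟩
  · simp [twoRows, tableauInsert, h]
  · simp [twoRows, tableauInsert, h, rowInsert_of_forall_lt hs]

lemma rowTwo_twoRows {r s : List ℕ} (hs : r = [] → s = []) :
    rowTwo (twoRows r s) = {z | ∃ q ∈ s, (q : ℤ) = z} := by
  rcases r with _ | ⟨a, r⟩
  · rw [hs rfl]; simp [rowTwo, twoRows]
  · rcases s with _ | ⟨b, s⟩ <;> simp [rowTwo, twoRows]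

lemma length_twoRows_le (r s : List ℕ) : (twoRows r s).length ≤ 2 := by
  rcases r with _ | ⟨a, r⟩
  · simp [twoRows]
  · rcases s with _ | ⟨b, s⟩ <;> simp [twoRows]

/-! ### Insertion as a stable matching. -/

/-- The inversions of `w` between the first `m` positions. -/
def InvBefore (m : ℕ) (w : Equiv.Perm (Fin n)) (b t : ℕ) : Prop :=
  ∃ i j : Fin n, i < j ∧ (j : ℕ) < m ∧ w j < w i ∧ (w j : ℕ) = b ∧ (w i : ℕ) = t

lemma InvBefore.inv {m : ℕ} {w : Equiv.Perm (Fin n)} {b t : ℕ} (h : InvBefore m w b t) :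
    Inv w b t := by
  obtain ⟨i, j, h1, _, h2⟩ := h
  exact ⟨i, j, h1, h2⟩

/-- The rows `r`, `s` are those of the insertion tableau of the first `m` entries of `w`, and `M`
matches the entries of `s` with the entries which have bumped them. -/
structure IsInsertionMatching (m : ℕ) (w : Equiv.Perm (Fin n)) (r s : List ℕ)
    (M : ℕ → ℕ → Prop) : Prop where
  sorted_fst : r.Pairwise (· < ·)
  sorted_snd : s.Pairwise (· < ·)
  mem_or : ∀ v, v ∈ r ∨ v ∈ s ↔ ∃ i : Fin n, (i : ℕ) < m ∧ v = w i + 1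
  disjoint : ∀ v ∈ r, v ∉ s
  mem_snd : ∀ v, v ∈ s ↔ ∃ t ∈ tops M, t + 1 = v
  stable : IsStable (InvBefore m w) M

lemma IsInsertionMatching.snd_eq_nil {m : ℕ} {w : Equiv.Perm (Fin n)} {r s : List ℕ}
    {M : ℕ → ℕ → Prop} (h : IsInsertionMatching m w r s M) (hw : Avoids321 w) (hr : r = []) :
    s = [] := by
  subst hr
  refine List.eq_nil_iff_forall_not_mem.2 fun v hv => ?_
  obtain ⟨t, ⟨b, hb⟩, rfl⟩ := (h.mem_snd v).1 hv
  obtain ⟨i, j, _, hj, _, rfl, rfl⟩ := h.stable.sub hb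
  have h1 := (h.mem_or _).2 ⟨j, hj, rfl⟩
  obtain ⟨t, ⟨b', hb'⟩, ht⟩ := (h.mem_snd _).1 (h1.resolve_left (by simp))
  obtain rfl : t = w j := by omega
  exact hw.isInvRel.not_both (h.stable.sub hb').inv (h.stable.sub hb).inv

lemma IsInsertionMatching.exists_succ {m : ℕ} (hm : m < n) {w : Equiv.Perm (Fin n)} {r s : List ℕ}
    {M : ℕ → ℕ → Prop} (h : IsInsertionMatching m w r s M) (hw : Avoids321 w) :
    ∃ r' s' M', IsInsertionMatching (m + 1) w r' s' M' ∧
      tableauInsert (twoRows r s) (w ⟨m, hm⟩ + 1) = twoRows r' s' := by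
  set p : Fin n := ⟨m, hm⟩ with hp
  have hpm : (p : ℕ) = m := rfl
  have hlt (i : Fin n) : (i : ℕ) < m + 1 ↔ (i : ℕ) < m ∨ i = p := by
    rw [Fin.ext_iff, hpm]; omega
  have hx : ∀ v, v ∈ r ∨ v ∈ s → v ≠ w p + 1 := by
    rintro v hv rfl
    obtain ⟨i, hi, h1⟩ := (h.mem_or _).1 hv
    have : p = i := w.injective (Fin.ext (by omega))
    omega
  -- Lower entries increase from left to right, so every earlier bumping entry is smaller than the
  -- new entry.
  have hlow {b t : ℕ} (hb : M b t) : b < w p := by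
    obtain ⟨i, j, hij, hj, hlt, rfl, rfl⟩ := h.stable.sub hb
    have h1 : w p ≠ w j := fun e => by have := congrArg Fin.val (w.injective e); omega
    by_contra hc
    have h2 := hw.lower_lt hij hlt (lt_of_le_of_ne (not_lt.1 hc) h1)
    rw [Fin.lt_def] at h2
    omega
  have hmono {b t : ℕ} (hbt : InvBefore m w b t) : InvBefore (m + 1) w b t := by
    obtain ⟨i, j, h1, h2, h3⟩ := hbt
    exact ⟨i, j, h1, by omega, h3⟩
  rcases rowInsert_spec h.sorted_fst (fun h' => hx _ (.inl h') rfl) with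
    h1 | ⟨z, r', h1, hz, hxz, hmin, hs', hr'⟩
  · refine ⟨r ++ [(w p : ℕ) + 1], s, M, ⟨?_, h.sorted_snd, ?_, ?_, h.mem_snd, ?_⟩,
      tableauInsert_twoRows_append h1 (h.snd_eq_nil hw)⟩
    · rw [List.pairwise_append]
      exact ⟨h.sorted_fst, by simp, fun a ha b hb => by
        rw [List.mem_singleton.1 hb]; exact h1 a ha⟩
    · intro v
      have := h.mem_or v
      simp only [List.mem_append, List.mem_singleton, hlt, or_and_right, exists_or,
        exists_eq_left, ← this]
      tauto
    · intro v hv hv'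
      rcases List.mem_append.1 hv with hv | hv
      · exact h.disjoint v hv hv'
      · exact hx v (.inr hv') (List.mem_singleton.1 hv)
    · refine ⟨fun hb => hmono (h.stable.sub hb), h.stable.left_unique, h.stable.right_unique, ?_⟩
      rintro b t ⟨i, j, hij, hj, hji, rfl, rfl⟩
      rcases (hlt j).1 hj with hj | rfl
      · exact h.stable.stable ⟨i, j, hij, hj, hji, rfl, rfl⟩
      · right
        rw [Fin.lt_def] at hij hji
        rcases (h.mem_or _).2 ⟨i, hij, rfl⟩ with h2 | h2
        · have := h1 _ h2; omega
        · obtain ⟨t, ⟨b, hb⟩, ht⟩ := (h.mem_snd _).1 h2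
          obtain rfl : t = w i := by omega
          exact ⟨b, (hlow hb).le, hb⟩
  · obtain ⟨i, him, rfl⟩ := (h.mem_or z).1 (.inl hz)
    have hip : i < p := him
    have hwpi : w p < w i := by rw [Fin.lt_def]; omega
    have hnot : (w i : ℕ) ∉ tops M := fun hc =>
      h.disjoint _ hz ((h.mem_snd _).2 ⟨_, hc, rfl⟩)
    -- The bumped entry goes to the end of the second row, so no third row arises: if a larger `t`
    -- had been bumped earlier by `b`, then `(b, w i)` would have blocked `M`.
    have hbig : ∀ v ∈ s, v < w i + 1 := by
      intro v hv
      obtain ⟨t, ⟨b, hb⟩, rfl⟩ := (h.mem_snd v).1 hv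
      have hbp := hlow hb
      by_contra hc
      have hne : t ≠ w i := by rintro rfl; exact hnot ⟨b, hb⟩
      obtain ⟨i', j', hij, hj, hji, rfl, rfl⟩ := h.stable.sub hb
      have h2 : i < i' := hw.upper_lt hip hwpi (by rw [Fin.lt_def]; omega)
      rw [Fin.lt_def] at hwpi
      rcases h.stable.stable ⟨i, j', h2.trans hij, hj, by rw [Fin.lt_def]; omega, rfl, rfl⟩ with
        ⟨t', ht, h3⟩ | ⟨b', _, h3⟩
      · have := h.stable.left_unique hb h3; omega
      · exact hnot ⟨b', h3⟩
    refine ⟨r', s ++ [(w i : ℕ) + 1], fun b t => M b t ∨ (b = w p ∧ t = w i),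
      ⟨hs', ?_, ?_, ?_, ?_, ?_⟩, tableauInsert_twoRows_bump h1 (List.ne_nil_of_mem hz)
        (List.ne_nil_of_mem ((hr' _).2 (.inl rfl))) hbig⟩
    · rw [List.pairwise_append]
      exact ⟨h.sorted_snd, by simp, fun a ha b hb => by
        rw [List.mem_singleton.1 hb]; exact hbig a ha⟩
    · intro v
      have h2 := h.mem_or v
      have h3 : v = w i + 1 → v ∈ r := by rintro rfl; exact hz
      simp only [List.mem_append, List.mem_singleton, hlt, or_and_right, exists_or,
        exists_eq_left, hr', ← h2]
      tauto
    · intro v hv hv'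
      rcases List.mem_append.1 hv' with hv' | hv' <;> rcases (hr' v).1 hv with rfl | hv
      · exact hx _ (.inr hv') rfl
      · exact h.disjoint v hv.1 hv'
      · rw [List.mem_singleton] at hv'; omega
      · exact hv.2 (List.mem_singleton.1 hv')
    · intro v
      simp only [List.mem_append, List.mem_singleton, h.mem_snd, tops, Set.mem_ofPred_eq]
      constructor
      · rintro (⟨t, ⟨b, hb⟩, rfl⟩ | rfl)
        · exact ⟨t, ⟨b, .inl hb⟩, rfl⟩
        · exact ⟨_, ⟨_, .inr ⟨rfl, rfl⟩⟩, rfl⟩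
      · rintro ⟨t, ⟨b, hb | ⟨rfl, rfl⟩⟩, rfl⟩
        · exact .inl ⟨t, ⟨b, hb⟩, rfl⟩
        · exact .inr rfl
    · refine ⟨?_, ?_, ?_, ?_⟩
      · rintro b t (hb | ⟨rfl, rfl⟩)
        · exact hmono (h.stable.sub hb)
        · exact ⟨i, p, hip, by omega, hwpi, rfl, rfl⟩
      · rintro b t t' (hb | ⟨rfl, rfl⟩) (hb' | ⟨h2, rfl⟩)
        · exact h.stable.left_unique hb hb'
        · have := hlow hb; omega
        · have := hlow hb'; omega
        · rfl
      · rintro b b' t (hb | ⟨rfl, rfl⟩) (hb' | ⟨rfl, h2⟩)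
        · exact h.stable.right_unique hb hb'
        · subst h2; exact absurd ⟨b, hb⟩ hnot
        · exact absurd ⟨b', hb'⟩ hnot
        · rfl
      · rintro b t ⟨i', j, hij, hj, hji, rfl, rfl⟩
        rcases (hlt j).1 hj with hj | rfl
        · rcases h.stable.stable ⟨i', j, hij, hj, hji, rfl, rfl⟩ with ⟨t, h2, h3⟩ | ⟨b, h2, h3⟩
          · exact .inl ⟨t, h2, .inl h3⟩
          · exact .inr ⟨b, h2, .inl h3⟩
        · rw [Fin.lt_def] at hij hji
          rcases (h.mem_or _).2 ⟨i', hij, rfl⟩ with h2 | h2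
          · have := hmin _ h2 (by omega)
            exact .inl ⟨w i, by omega, .inr ⟨rfl, rfl⟩⟩
          · obtain ⟨t, ⟨b, hb⟩, ht⟩ := (h.mem_snd _).1 h2
            obtain rfl : t = w i' := by omega
            exact .inr ⟨b, (hlow hb).le, .inl hb⟩

lemma Avoids321.exists_insertionMatching {w : Equiv.Perm (Fin n)} (hw : Avoids321 w) :
    ∃ r s M, IsInsertionMatching n w r s M ∧ insertionTableau w = twoRows r s := by
  have key : ∀ m ≤ n, ∃ r s M, IsInsertionMatching m w r s M ∧
      ((oneLine w).take m).foldl tableauInsert [] = twoRows r s := by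
    intro m
    induction m with
    | zero =>
      refine fun _ => ⟨[], [], fun _ _ => False, ⟨by simp, by simp, by simp, by simp,
        by simp [tops], ⟨False.elim, False.elim, False.elim, ?_⟩⟩, rfl⟩
      rintro b t ⟨i, j, _, hj, _⟩
      omega
    | succ m ih =>
      intro hm
      obtain ⟨r, s, M, h1, h2⟩ := ih (by omega)
      obtain ⟨r', s', M', h3, h4⟩ := h1.exists_succ hm hw
      refine ⟨r', s', M', h3, ?_⟩
      rw [List.take_add_one, List.foldl_append, h2, ← h4]
      simp [oneLine, show m < n from hm]
  obtain ⟨r, s, M, h1, h2⟩ := key n le_rfl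
  refine ⟨r, s, M, h1, ?_⟩
  rwa [List.take_of_length_le (by simp [oneLine])] at h2

/-! ### From matchings back to tableaux. -/

lemma isStable_inv {w : Equiv.Perm (Fin n)} {r s : List ℕ} {M : ℕ → ℕ → Prop}
    (h : IsInsertionMatching n w r s M) : IsStable (Inv w) M where
  sub hb := (h.stable.sub hb).inv
  left_unique := h.stable.left_unique
  right_unique := h.stable.right_unique
  stable := by
    rintro b t ⟨i, j, hij, hji⟩
    exact h.stable.stable ⟨i, j, hij, j.2, hji⟩

lemma IsInsertionMatching.isUncrowdedTableau_iff {w : Equiv.Perm (Fin n)} {r s : List ℕ}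
    {M : ℕ → ℕ → Prop} (h : IsInsertionMatching n w r s M) (hw : Avoids321 w) :
    IsUncrowdedTableau (twoRows r s) ↔
      ∀ a x, 0 < x → countIcc (tops M) a (a + 2 * x) ≤ x + 1 := by
  rw [IsUncrowdedTableau, rowTwo_twoRows (h.snd_eq_nil hw), ← isUncrowdedSet_iff]
  have : {z : ℤ | ∃ q ∈ s, (q : ℤ) = z} = {z | ∃ t ∈ tops M, ((t : ℤ) + 1) = z} := by
    ext z
    simp only [Set.mem_ofPred_eq, h.mem_snd]
    constructor
    · rintro ⟨_, ⟨t, ht, rfl⟩, rfl⟩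
      exact ⟨t, ht, by push_cast; rfl⟩
    · rintro ⟨t, ht, rfl⟩
      exact ⟨_, ⟨t, ht, rfl⟩, by push_cast; rfl⟩
  rw [this]
  exact and_iff_right (length_twoRows_le r s)

lemma eq_of_pairwise_lt {r r' : List ℕ} (hr : r.Pairwise (· < ·)) (hr' : r'.Pairwise (· < ·))
    (h : ∀ v, v ∈ r ↔ v ∈ r') : r = r' :=
  List.Perm.eq_of_pairwise (fun _ _ _ _ h1 h2 => absurd h1 (lt_asymm h2)) hr hr'
    ((List.perm_ext_iff_of_nodup (hr.imp fun h => h.ne) (hr'.imp fun h => h.ne)).2 h)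

lemma IsInsertionMatching.twoRows_eq {c w : Equiv.Perm (Fin n)} {r s r' s' : List ℕ}
    {M N : ℕ → ℕ → Prop} (h : IsInsertionMatching n w r s M)
    (h' : IsInsertionMatching n c r' s' N) (hMN : tops N = tops M) :
    twoRows r' s' = twoRows r s := by
  have hs : ∀ v, v ∈ s' ↔ v ∈ s := fun v => by rw [h.mem_snd, h'.mem_snd, hMN]
  have hor {v : ℕ} {u : Equiv.Perm (Fin n)} : (∃ i : Fin n, (i : ℕ) < n ∧ v = u i + 1) ↔
      ∃ i : Fin n, v = i + 1 :=
    ⟨fun ⟨i, _, hi⟩ => ⟨_, hi⟩, fun ⟨i, hi⟩ => ⟨u⁻¹ i, Fin.is_lt _, by simpa using hi⟩⟩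
  have hr : ∀ v, v ∈ r' ↔ v ∈ r := fun v => by
    have h1 := h.mem_or v
    have h2 := h'.mem_or v
    rw [hor] at h1 h2
    have h3 := h.disjoint v
    have h4 := h'.disjoint v
    have h5 := hs v
    tauto
  rw [eq_of_pairwise_lt h'.sorted_fst h.sorted_fst hr, eq_of_pairwise_lt h'.sorted_snd h.sorted_snd hs]

/-- For a pair `b < y ≤ t`, either `t` stands before position `y` and goes up across the cut, or `b`
stands at or after it and goes down. Thin cuts allow one pair of each kind. -/
lemma ThinCuts.card_crossing_le {c : Equiv.Perm (Fin n)} (hc : ThinCuts c) {M : ℕ → ℕ → Prop}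
    (hM : IsStable (Inv c) M) (y : ℕ) (K : Finset ℕ)
    (hK : ∀ t ∈ K, ∃ b, M b t ∧ b < y ∧ y ≤ t) : K.card ≤ 2 := by
  classical
  rw [← Finset.card_filter_add_card_filter_not (s := K)
    fun t => ∃ i : Fin n, (i : ℕ) < y ∧ (c i : ℕ) = t]
  refine add_le_add (b := 1) (d := 1) (Finset.card_le_one.2 ?_) (Finset.card_le_one.2 ?_)
  · intro t ht t' ht'
    obtain ⟨h1, i, hi, rfl⟩ := Finset.mem_filter.1 ht
    obtain ⟨h2, j, hj, rfl⟩ := Finset.mem_filter.1 ht'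
    obtain ⟨_, _, _, h3⟩ := hK _ h1
    obtain ⟨_, _, _, h4⟩ := hK _ h2
    rw [hc.1 y i j hi hj h3 h4]
  · have key : ∀ t ∈ K, (¬ ∃ i : Fin n, (i : ℕ) < y ∧ (c i : ℕ) = t) →
        ∃ j : Fin n, M (c j) t ∧ y ≤ j ∧ (c j : ℕ) < y := by
      intro t ht hn
      obtain ⟨b, hb, hby, _⟩ := hK t ht
      obtain ⟨i, j, hij, _, rfl, rfl⟩ := hM.sub hb
      refine ⟨j, hb, ?_, hby⟩
      by_contra hj
      exact hn ⟨i, lt_trans hij (not_le.1 hj), rfl⟩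
    intro t ht t' ht'
    rw [Finset.mem_filter] at ht ht'
    obtain ⟨i, h1, h2, h3⟩ := key t ht.1 ht.2
    obtain ⟨j, h4, h5, h6⟩ := key t' ht'.1 ht'.2
    obtain rfl := hc.2 y i j h2 h5 h3 h6
    exact hM.left_unique h1 h4

end FCPerm

theorem corollary4p12 (n : ℕ) (w : Equiv.Perm (Fin n)) (hw : FCPerm.IsFullyCommutative w) :
    (∃! c : Equiv.Perm (Fin n), FCPerm.IsBooleanCore c w) ∧
      ∀ c : Equiv.Perm (Fin n), FCPerm.IsBooleanCore c w →
        (FCPerm.IsUncrowded w ↔ FCPerm.insertionTableau c = FCPerm.insertionTableau w) := by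
  have hav := hw.braidFree.avoids321
  obtain ⟨c, hc⟩ := hw.braidFree.exists_isBooleanCore
  refine ⟨⟨c, hc, fun c' hc' => hc'.unique hc hav⟩, fun c hc => ?_⟩
  have hcv := hc.avoids321 hav
  obtain ⟨r, s, M, hM, hT⟩ := hav.exists_insertionMatching
  obtain ⟨r', s', N, hN, hT'⟩ := hcv.exists_insertionMatching
  have hMs := FCPerm.isStable_inv hM
  have hNs := FCPerm.isStable_inv hN
  constructor
  · intro h
    rw [FCPerm.IsUncrowded, hT, hM.isUncrowdedTableau_iff hav] at h
    have he : FCPerm.Inv c = FCPerm.Innermost (FCPerm.Inv w) :=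
      funext₂ fun b t => propext (hc.inv_iff hav b t)
    rw [hT, hT']
    exact hM.twoRows_eq hN (FCPerm.tops_innermost_eq hav.isInvRel hMs (he ▸ hNs) h)
  · intro h
    rw [FCPerm.IsUncrowded, ← h, hT', hN.isUncrowdedTableau_iff hcv]
    exact fun a x _ => FCPerm.countIcc_tops_le hcv.isInvRel hNs
      (hc.1.thinCuts.card_crossing_le hNs) a x
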